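/- Let $T:[0,1)\to[0,1)$ be the Gauss map, $Tx=x^{-1}-\lfloor x^{-1}\rfloor$ for $x\neq 0$ and $T0=0$, and let $\mu$ be the Gauss measure on $[0,1)$, $\mu(A)=\int_A \frac{dx}{(1+x)\log 2}$. Write $\langle a_1,a_2,a_3,\dots\rangle$ for the value in $[0,1)$ of the infinite continued fraction $$\cfrac{1}{a_1+\cfrac{1}{a_2+\cfrac{1}{a_3+\cdots}}}$$ with positive integer digits $a_i$. For a finite string $s=[d_1,\dots,d_\ell]$ of positive integers let $C_s$ be the set of $x\in[0,1)$ whose first $\ell$ continued fraction digits are $d_1,\dots,d_\ell$, where the $i$-th digit of $x$ is $\lfloor (T^{i-1}x)^{-1}\rfloor$ as long as $T^{i-1}x\neq 0$. A number $x\in[0,1)$ is called CF-normal if for every non-empty finite string $s$ of positive integers $$\lim_{n\to\infty}\frac{\#\{0\le i\le n: T^ix\in C_s\}}{n}=\mu(C_s).$$ Theorem. Suppose that $\langle a_1,a_2,a_3,\dots\rangle$ is CF-normal. Then for all integers $k\ge 1$ and $m\ge 2$ the number $\langle a_k,a_{m+k},a_{2m+k},a_{3m+k},\dots\rangle$ is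 not CF-normal. More precisely, for all such $k,m$ the limiting frequency of the string $[1,1]$ in this subsequence exists and $$\lim_{n\to\infty}\frac{\#\{1\le i\le n: a_{(i-1)m+k}=a_{im+k}=1\}}{n}=\mu\left(C_{[1]}\cap T^{-m}C_{[1]}\right)>\mu(C_{[1,1]})=\frac{\log(10/9)}{\log 2}.$$ In particular this limit does not equal $\mu(C_{[1,1]})$. -/

import Mathlib

open Set Filter Topology MeasureTheory

/-- The Gauss map `T x = x⁻¹ - ⌊x⁻¹⌋`; as `0⁻¹ = 0`, this gives `T 0 = 0`. -/
noncomputable def gaussMap (x : ℝ) : ℝ := Int.fract x⁻¹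

/-- The Gauss measure on `[0, 1)`: density `1 / ((1 + x) log 2)` with respect to Lebesgue
measure. -/
noncomputable def gaussMeasure : Measure ℝ :=
  (volume.restrict (Ico (0 : ℝ) 1)).withDensity
    fun x => ENNReal.ofReal (1 / ((1 + x) * Real.log 2))

/-- The continued fraction digit of `x` at (zero-based) position `i`, that is `⌊(Tⁱ x)⁻¹⌋`.
It is `0` once the expansion of a rational `x` has terminated. -/
noncomputable def cfDigit (x : ℝ) (i : ℕ) : ℕ := ⌊(gaussMap^[i] x)⁻¹⌋₊

/-- The cylinder set `C_s`: the points of `[0, 1)` whose first digits are those of the string `s`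
of positive integers. -/
def cfCylinder (s : List ℕ+) : Set ℝ :=
  {x | x ∈ Ico (0 : ℝ) 1 ∧ ∀ (i : ℕ) (hi : i < s.length), cfDigit x i = (s[i] : ℕ)}

/-- `x ∈ [0, 1)` is CF-normal if every non-empty finite string `s` of positive integers occurs
in the expansion of `x` with limiting frequency `μ(C_s)`. -/
def CFNormal (x : ℝ) : Prop :=
  x ∈ Ico (0 : ℝ) 1 ∧ ∀ s : List ℕ+, s ≠ [] →
    Tendsto (fun n : ℕ => ({i : ℕ | i ≤ n ∧ gaussMap^[i] x ∈ cfCylinder s}.ncard : ℝ) / n)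
      atTop (𝓝 (gaussMeasure.real (cfCylinder s)))

/-- The formal continued fraction `⟨d 0, d 1, d 2, …⟩ = 1 / (d 0 + 1 / (d 1 + 1 / (d 2 + …)))`. -/
noncomputable def cfOfDigits (d : ℕ → ℕ+) : GenContFract ℝ :=
  ⟨0, Stream'.Seq.ofStream fun i => ⟨1, ((d i : ℕ) : ℝ)⟩⟩

/-- `x` is the value of the infinite continued fraction `⟨d 0, d 1, d 2, …⟩`: its convergents
tend to `x`. -/
def HasCFValue (d : ℕ → ℕ+) (x : ℝ) : Prop :=
  Tendsto (cfOfDigits d).convs atTop (𝓝 x)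

/-! Let `E` be the event that the digits at positions `0` and `m` are both `1`. The claim is that
`E` occurs along every progression of difference `m` with its Gauss frequency `μ(E)`, and that `μ(E)
> μ(C_[1,1])`; along the subsequence, `E` is the occurrence of `[1,1]`.

CF-normality gives the frequency of every finite pattern of ones along all times
(`tendsto_frequency_ones`), hence the autocorrelations of the centred indicator of `E`. These tend
to `0` because the Gauss map mixes, and a van der Corput argument then forces the averages along a
progression to vanish (`tendsto_average_arithmetic_progression`).

Mixing rests on the transfer operator `gaussTransfer`, which exchanges increasing and decreasing
functions and at least halves the gap between the values at `0` and `1`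
(`gaussTransfer_iterate_spread`). The event `E` has no monotone indicator, but two steps past its
second digit its density is a product of monotone functions (`abs_measureReal_two_ones_sub_le`,
where "past" means after transfer through `m + 1` steps).

For the inequality, `1 / (2 + x)` is the conditional probability that the digit preceding `x` is
`1`. It decreases in `x`, so it is smallest where `x` itself starts with `1`. Bounding it above and
below gives `μ(E) ≥ (11/30) μ(C_[1])`, which just exceeds `μ(C_[1,1])`
(`measureReal_cfCylinder_one_one_lt`). -/

/-! ### Values and digits of infinite continued fractions. -/

/-- The `n`-th approximant of `⟨d 0, d 1, …⟩`, evaluated from the outside in. -/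
noncomputable def cfApprox : ℕ → (ℕ → ℕ+) → ℝ
  | 0, _ => 0
  | n + 1, d => 1 / ((d 0 : ℕ) + cfApprox n fun i => d (i + 1))

lemma one_le_pnat_cast (k : ℕ+) : (1 : ℝ) ≤ ((k : ℕ) : ℝ) := by exact_mod_cast one_le

lemma convs'Aux_cfOfDigits (n : ℕ) (d : ℕ → ℕ+) :
    GenContFract.convs'Aux (cfOfDigits d).s n = cfApprox n d := by
  induction n generalizing d with
  | zero => rfl
  | succ n ih =>
    have h := ih fun i => d (i + 1)
    have e : Stream'.Seq.tail (cfOfDigits d).s = (cfOfDigits fun i => d (i + 1)).s := by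
      ext1 i
      rfl
    rw [GenContFract.convs'Aux, cfApprox, e, h]
    rfl

lemma convs_cfOfDigits (d : ℕ → ℕ+) (n : ℕ) : (cfOfDigits d).convs n = cfApprox n d := by
  rw [GenContFract.convs_eq_convs', GenContFract.convs', convs'Aux_cfOfDigits]
  · simp [cfOfDigits]
  · intro gp m _ h
    have h' : some (⟨1, ((d m : ℕ) : ℝ)⟩ : GenContFract.Pair ℝ) = some gp := h
    obtain rfl := Option.some.inj h'
    exact ⟨one_pos, by have := one_le_pnat_cast (d m); positivity⟩

lemma cfApprox_mem_Icc (n : ℕ) (d : ℕ → ℕ+) : cfApprox n d ∈ Icc (0 : ℝ) 1 := by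
  induction n generalizing d with
  | zero => simp [cfApprox]
  | succ n ih =>
    have h := ih fun i => d (i + 1)
    have h1 := one_le_pnat_cast (d 0)
    rw [cfApprox]
    exact ⟨by have := h.1; positivity, by rw [div_le_one] <;> linarith [h.1]⟩

/-- Two steps are taken at once because a single step `s ↦ 1 / (1 + s)` has derivative `-1` at `0`
and is not a uniform contraction. -/
lemma abs_two_step_sub_le {a b s t : ℝ} (ha : 1 ≤ a) (hb : 1 ≤ b) (hs : 0 ≤ s) (ht : 0 ≤ t) :
    |1 / (a + 1 / (b + s)) - 1 / (a + 1 / (b + t))| ≤ 1 / 4 * |s - t| := by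
  have hs' : 2 ≤ a * (b + s) + 1 := by nlinarith
  have ht' : 2 ≤ a * (b + t) + 1 := by nlinarith
  have e : 1 / (a + 1 / (b + s)) - 1 / (a + 1 / (b + t))
      = (s - t) / ((a * (b + s) + 1) * (a * (b + t) + 1)) := by
    have : b + s ≠ 0 := by positivity
    have : b + t ≠ 0 := by positivity
    have : a * (b + s) + 1 ≠ 0 := by positivity
    have : a * (b + t) + 1 ≠ 0 := by positivity
    field_simp
    ring
  rw [e, abs_div, abs_of_pos (a := (a * (b + s) + 1) * (a * (b + t) + 1)) (by positivity),
    div_le_iff₀ (by positivity)]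
  have : 4 ≤ (a * (b + s) + 1) * (a * (b + t) + 1) := by nlinarith
  nlinarith [abs_nonneg (s - t)]

lemma abs_cfApprox_sub_le (j n n' : ℕ) (d : ℕ → ℕ+) :
    |cfApprox (n + 2 * j) d - cfApprox (n' + 2 * j) d| ≤ (1 / 4) ^ j := by
  induction j generalizing d with
  | zero =>
    have h1 := cfApprox_mem_Icc n d
    have h2 := cfApprox_mem_Icc n' d
    simp only [mul_zero, add_zero, pow_zero]
    exact abs_le.2 ⟨by linarith [h1.1, h2.2], by linarith [h1.2, h2.1]⟩
  | succ j ih =>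
    have h := ih fun i => d (i + 1 + 1)
    have e : ∀ k, k + 2 * (j + 1) = (k + 2 * j) + 1 + 1 := fun k => by ring
    rw [e, e, cfApprox, cfApprox, cfApprox, cfApprox]
    refine (abs_two_step_sub_le (one_le_pnat_cast _) (one_le_pnat_cast _)
      (cfApprox_mem_Icc _ _).1 (cfApprox_mem_Icc _ _).1).trans ?_
    rw [pow_succ]
    linarith

lemma cauchySeq_cfApprox (d : ℕ → ℕ+) : CauchySeq fun n => cfApprox n d := by
  refine Metric.cauchySeq_iff.2 fun ε hε => ?_
  obtain ⟨j, hj⟩ := exists_pow_lt_of_lt_one hε (show (1 / 4 : ℝ) < 1 by norm_num)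
  refine ⟨2 * j, fun n hn n' hn' => ?_⟩
  have h := abs_cfApprox_sub_le j (n - 2 * j) (n' - 2 * j) d
  rw [Nat.sub_add_cancel hn, Nat.sub_add_cancel hn'] at h
  exact h.trans_lt hj

lemma exists_hasCFValue (d : ℕ → ℕ+) : ∃ x, HasCFValue d x := by
  obtain ⟨x, hx⟩ := cauchySeq_tendsto_of_complete (cauchySeq_cfApprox d)
  exact ⟨x, hx.congr fun n => (convs_cfOfDigits d n).symm⟩

namespace HasCFValue

variable {d : ℕ → ℕ+} {x : ℝ}

lemma tendsto_cfApprox (h : HasCFValue d x) : Tendsto (fun n => cfApprox n d) atTop (𝓝 x) :=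
  Tendsto.congr (fun n => convs_cfOfDigits d n) h

lemma mem_Icc (h : HasCFValue d x) : x ∈ Icc (0 : ℝ) 1 :=
  isClosed_Icc.mem_of_tendsto h.tendsto_cfApprox
    (Eventually.of_forall fun n => cfApprox_mem_Icc n d)

lemma eq_one_div (h : HasCFValue d x) {y : ℝ} (hy : HasCFValue (fun i => d (i + 1)) y) :
    x = 1 / ((d 0 : ℕ) + y) := by
  have h1 := h.tendsto_cfApprox.comp (tendsto_add_atTop_nat 1)
  refine tendsto_nhds_unique h1 ?_
  have := one_le_pnat_cast (d 0)
  exact tendsto_const_nhds.div (hy.tendsto_cfApprox.const_add _) (by linarith [hy.mem_Icc.1])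

/-- Both strict bounds matter: they make each tail a genuine fractional part, so that the Gauss map
shifts the digits and the expansion never terminates. -/
lemma mem_Ioo (h : HasCFValue d x) : x ∈ Ioo (0 : ℝ) 1 := by
  have pos : ∀ {d x}, HasCFValue d x → 0 < x := by
    intro d x h
    obtain ⟨y, hy⟩ := exists_hasCFValue fun i => d (i + 1)
    have := one_le_pnat_cast (d 0)
    have := hy.mem_Icc.1
    rw [h.eq_one_div hy]
    positivity
  refine ⟨pos h, ?_⟩
  obtain ⟨y, hy⟩ := exists_hasCFValue fun i => d (i + 1)
  have h1 := one_le_pnat_cast (d 0)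
  have h2 := pos hy
  rw [h.eq_one_div hy, div_lt_one (by positivity)]
  linarith

lemma inv_eq (h : HasCFValue d x) {y : ℝ} (hy : HasCFValue (fun i => d (i + 1)) y) :
    x⁻¹ = (d 0 : ℕ) + y := by
  rw [h.eq_one_div hy, one_div, inv_inv]

lemma gaussMap_eq (h : HasCFValue d x) {y : ℝ} (hy : HasCFValue (fun i => d (i + 1)) y) :
    gaussMap x = y := by
  rw [gaussMap, h.inv_eq hy, Int.fract_natCast_add, Int.fract_eq_self]
  exact ⟨hy.mem_Ioo.1.le, hy.mem_Ioo.2⟩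

lemma iterate (h : HasCFValue d x) (n : ℕ) :
    HasCFValue (fun i => d (i + n)) (gaussMap^[n] x) := by
  induction n with
  | zero => exact h
  | succ n ih =>
    obtain ⟨y, hy⟩ := exists_hasCFValue fun i => d (i + 1 + n)
    rw [Function.iterate_succ_apply', ih.gaussMap_eq hy]
    convert hy using 3
    ring

lemma cfDigit_eq (h : HasCFValue d x) (n : ℕ) : cfDigit x n = d n := by
  have h1 := h.iterate n
  obtain ⟨y, hy⟩ := exists_hasCFValue fun i => d (i + 1 + n)
  have h2 := hy.mem_Ioo
  rw [cfDigit, h1.inv_eq hy, zero_add, Nat.floor_eq_iff (by have := h2.1; positivity)]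
  exact ⟨by linarith [h2.1], by linarith [h2.2]⟩

end HasCFValue

/-! ### Frequencies of infinite families of words. -/

-- No mass escapes to infinity: as the limits `p` sum to `1`, a finite set `F` carries almost all of
-- it, so the words outside `F` have small upper frequency and `W` may be replaced by `W ∩ F`.
open Classical in
lemma tendsto_frequency_of_countable {X : Type*} (w : ℕ → X) (p : X → ℝ)
    (hp : HasSum p 1) (p_nonneg : ∀ s, 0 ≤ p s)
    (h : ∀ s, Tendsto (fun N : ℕ => (∑ n ∈ Finset.range N, if w n = s then (1 : ℝ) else 0) / N)
      atTop (𝓝 (p s))) (W : Set X) :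
    Tendsto (fun N : ℕ => (∑ n ∈ Finset.range N, if w n ∈ W then (1 : ℝ) else 0) / N)
      atTop (𝓝 (∑' s, W.indicator p s)) := by
  refine Metric.tendsto_nhds.2 fun ε hε => ?_
  obtain ⟨F, hF⟩ := ((hp.eventually (lt_mem_nhds (show 1 - ε / 4 < 1 by linarith)))).exists
  have hsum : Summable (W.indicator p) := hp.summable.indicator W
  have hFW : Tendsto (fun N : ℕ => ∑ s ∈ F, (if s ∈ W then (1 : ℝ) else 0) *
      ((∑ n ∈ Finset.range N, if w n = s then (1 : ℝ) else 0) / N)) atTop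
      (𝓝 (∑ s ∈ F, W.indicator p s)) := by
    refine (tendsto_finsetSum F fun s _ => (h s).const_mul (if s ∈ W then (1 : ℝ) else 0)).trans ?_
    simp [Set.indicator_apply]
  have hF1 := tendsto_finsetSum F fun s _ => h s
  have e1 : ∀ N : ℕ, ∑ s ∈ F, (if s ∈ W then (1 : ℝ) else 0) *
      ((∑ n ∈ Finset.range N, if w n = s then (1 : ℝ) else 0) / N)
      = (∑ n ∈ Finset.range N, if w n ∈ F ∧ w n ∈ W then (1 : ℝ) else 0) / N := by
    intro N
    simp_rw [← mul_div_assoc, ← Finset.sum_div, Finset.mul_sum]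
    rw [Finset.sum_comm]
    congr 1
    refine Finset.sum_congr rfl fun n _ => ?_
    simp [ite_and]
  have e2 : ∀ N : ℕ, ∑ s ∈ F, (∑ n ∈ Finset.range N, if w n = s then (1 : ℝ) else 0) / N
      = (∑ n ∈ Finset.range N, if w n ∈ F then (1 : ℝ) else 0) / N := by
    intro N
    simp_rw [← Finset.sum_div]
    rw [Finset.sum_comm]
    congr 1
    refine Finset.sum_congr rfl fun n _ => ?_
    simp
  simp_rw [e1] at hFW
  simp_rw [e2] at hF1
  have t1 : ∑ s ∈ F, W.indicator p s ≤ ∑' s, W.indicator p s :=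
    hsum.sum_le_tsum F fun s _ => indicator_nonneg (fun s _ => p_nonneg s) s
  have t2 : ∑' s, W.indicator p s - ∑ s ∈ F, W.indicator p s ≤ 1 - ∑ s ∈ F, p s := by
    have a1 := (hsum.hasSum.sub (hasSum_sum_of_ne_finset_zero (s := F)
      (f := fun s => if s ∈ F then W.indicator p s else 0) fun s hs => if_neg hs))
    have a2 := (hp.sub (hasSum_sum_of_ne_finset_zero (s := F)
      (f := fun s => if s ∈ F then p s else 0) fun s hs => if_neg hs))
    rw [Finset.sum_congr rfl fun s hs => if_pos hs] at a1 a2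
    refine hasSum_le (fun s => ?_) a1 a2
    by_cases hs : s ∈ F <;> by_cases hW : s ∈ W <;> simp [hs, hW, p_nonneg s]
  filter_upwards [Metric.tendsto_nhds.1 hFW (ε / 4) (by linarith),
    hF1.eventually (lt_mem_nhds hF), eventually_ge_atTop 1] with N h1 h2 h3
  have hN : (0 : ℝ) < N := by exact_mod_cast h3
  have k1 : (∑ n ∈ Finset.range N, if w n ∈ F ∧ w n ∈ W then (1 : ℝ) else 0) / N
      ≤ (∑ n ∈ Finset.range N, if w n ∈ W then (1 : ℝ) else 0) / N := by
    refine div_le_div_of_nonneg_right (Finset.sum_le_sum fun n _ => ?_) hN.le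
    by_cases a : w n ∈ F <;> by_cases b : w n ∈ W <;> simp [a, b]
  -- Summed from the pointwise inequality `1_W + 1_F ≤ 1_{F ∩ W} + 1`.
  have k2 : (∑ n ∈ Finset.range N, if w n ∈ W then (1 : ℝ) else 0) / N
      + (∑ n ∈ Finset.range N, if w n ∈ F then (1 : ℝ) else 0) / N
      ≤ (∑ n ∈ Finset.range N, if w n ∈ F ∧ w n ∈ W then (1 : ℝ) else 0) / N + 1 := by
    have e : (1 : ℝ) = (∑ n ∈ Finset.range N, (1 : ℝ)) / N := by
      rw [Finset.sum_const, Finset.card_range, nsmul_one, div_self hN.ne']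
    refine le_of_le_of_eq ?_ (congrArg (_ + ·) e.symm)
    rw [← add_div, ← add_div, ← Finset.sum_add_distrib, ← Finset.sum_add_distrib]
    refine div_le_div_of_nonneg_right (Finset.sum_le_sum fun n _ => ?_) hN.le
    by_cases a : w n ∈ F <;> by_cases b : w n ∈ W <;> simp [a, b]
  rw [Real.dist_eq, abs_lt] at h1 ⊢
  constructor <;> linarith [h1.1, h1.2]

/-! ### Averages along arithmetic progressions, by van der Corput's method. -/

lemma abs_sum_range_shift_sub_le {v : ℕ → ℝ} (hv : ∀ n, |v n| ≤ 1) (k N : ℕ) :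
    |∑ i ∈ Finset.range N, v (i + k) - ∑ i ∈ Finset.range N, v i| ≤ 2 * k := by
  have e1 := Finset.sum_range_add v N k
  have e2 := Finset.sum_range_add v k N
  rw [add_comm k N] at e2
  have e3 : ∑ i ∈ Finset.range N, v (i + k) = ∑ i ∈ Finset.range N, v (k + i) :=
    Finset.sum_congr rfl fun i _ => by rw [add_comm]
  have b1 : |∑ i ∈ Finset.range k, v (N + i)| ≤ k :=
    (Finset.abs_sum_le_sum_abs _ _).trans
      ((Finset.sum_le_sum fun i _ => hv (N + i)).trans (by simp))
  have b2 : |∑ i ∈ Finset.range k, v i| ≤ k :=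
    (Finset.abs_sum_le_sum_abs _ _).trans ((Finset.sum_le_sum fun i _ => hv i).trans (by simp))
  rw [abs_le] at *
  constructor <;> linarith [b1.1, b1.2, b2.1, b2.2]

lemma tendsto_average_shift {v : ℕ → ℝ} (hv : ∀ n, |v n| ≤ 1) (k : ℕ) {l : ℝ}
    (h : Tendsto (fun N : ℕ => (∑ n ∈ Finset.range N, v n) / N) atTop (𝓝 l)) :
    Tendsto (fun N : ℕ => (∑ n ∈ Finset.range N, v (n + k)) / N) atTop (𝓝 l) := by
  have h0 : Tendsto (fun N : ℕ => (∑ n ∈ Finset.range N, v (n + k)) / N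
      - (∑ n ∈ Finset.range N, v n) / N) atTop (𝓝 0) := by
    refine squeeze_zero_norm (fun N => ?_) (tendsto_const_div_atTop_nhds_zero_nat (2 * k : ℝ))
    rw [← sub_div, norm_div, Real.norm_eq_abs, Real.norm_natCast]
    exact div_le_div_of_nonneg_right (abs_sum_range_shift_sub_le hv k N) (Nat.cast_nonneg N)
  simpa using h0.add h

lemma tendsto_average_correlation {u c : ℕ → ℝ} (hu : ∀ n, |u n| ≤ 1)
    (hc : ∀ h, Tendsto (fun N : ℕ => (∑ n ∈ Finset.range N, u n * u (n + h)) / N)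
      atTop (𝓝 (c h))) (a b : ℕ) :
    Tendsto (fun N : ℕ => (∑ n ∈ Finset.range N, u (n + a) * u (n + b)) / N)
      atTop (𝓝 (c (max a b - min a b))) := by
  have key : ∀ a b, a ≤ b → Tendsto
      (fun N : ℕ => (∑ n ∈ Finset.range N, u (n + a) * u (n + b)) / N) atTop (𝓝 (c (b - a))) := by
    intro a b hab
    refine (tendsto_average_shift (v := fun n => u n * u (n + (b - a))) (fun n => ?_) a
      (hc (b - a))).congr fun N => ?_
    · rw [abs_mul]
      exact mul_le_one₀ (hu _) (abs_nonneg _) (hu _)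
    · congr 1
      refine Finset.sum_congr rfl fun n _ => ?_
      rw [show n + a + (b - a) = n + b by omega]
  rcases le_total a b with h | h
  · rw [max_eq_right h, min_eq_left h]
    exact key a b h
  · rw [max_eq_left h, min_eq_right h]
    simpa only [mul_comm] using key b a h

/-- A bounded sequence whose autocorrelations exist and tend to zero averages to zero along
every arithmetic progression. -/
lemma tendsto_average_arithmetic_progression {u c : ℕ → ℝ} (hu : ∀ n, |u n| ≤ 1)
    (hc : ∀ h, Tendsto (fun N : ℕ => (∑ n ∈ Finset.range N, u n * u (n + h)) / N)
      atTop (𝓝 (c h))) (c_zero : Tendsto c atTop (𝓝 0)) {m : ℕ} (hm : 1 ≤ m) (r : ℕ) :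
    Tendsto (fun N : ℕ => (∑ i ∈ Finset.range N, u (i * m + r)) / N) atTop (𝓝 0) := by
  refine Metric.tendsto_nhds.2 fun δ hδ => ?_
  have hm' : (0 : ℝ) < m := by exact_mod_cast hm
  -- Chosen so that the final mean-square bound `3 m ε M²` is exactly `(M δ / 2)²`.
  obtain ⟨ε, hε, hεδ⟩ : ∃ ε : ℝ, 0 < ε ∧ 3 * m * ε = (δ / 2) ^ 2 :=
    ⟨(δ / 2) ^ 2 / (3 * m), by positivity, by field_simp⟩
  obtain ⟨R, hR⟩ := eventually_atTop.1 (Metric.tendsto_nhds.1 c_zero ε hε)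
  replace hR : ∀ h, R + 1 ≤ h → c h ≤ ε := fun h hh => by
    have := hR h (by omega)
    rw [Real.dist_eq, sub_zero] at this
    exact (le_abs_self _).trans this.le
  -- With `M > 1 / ε` the diagonal contribution `M` to the mean square is absorbed by `M² ε`.
  obtain ⟨M, hM⟩ := exists_nat_gt (1 / ε)
  have hM0 : (0 : ℝ) < M := (by positivity : 0 < 1 / ε).trans hM
  have hMε : (M : ℝ) ≤ M ^ 2 * ε := by
    rw [div_lt_iff₀ hε] at hM
    nlinarith
  -- The shifts are multiples of `m`, so they preserve the progression, and distinct ones differ by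
  -- more than `R`, so their correlations are at most `ε`. `V` will be the mean square of `S` over
  -- all integers.
  set S : ℕ → ℝ := fun n => ∑ j ∈ Finset.range M, u (n + j * (R + 1) * m) with hS
  set V : ℝ := ∑ j ∈ Finset.range M, ∑ j' ∈ Finset.range M,
    c (max (j * (R + 1) * m) (j' * (R + 1) * m) - min (j * (R + 1) * m) (j' * (R + 1) * m))
    with hV
  have c_le_one : ∀ h, c h ≤ 1 := fun h => by
    refine le_of_tendsto (hc h) (Eventually.of_forall fun N => ?_)
    refine div_le_one_of_le₀ ?_ (Nat.cast_nonneg N)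
    refine (Finset.sum_le_sum fun n _ => (?_ : _ ≤ (1 : ℝ))).trans (by simp)
    refine (le_abs_self _).trans ?_
    rw [abs_mul]
    exact mul_le_one₀ (hu _) (abs_nonneg _) (hu _)
  have V_le : V ≤ M + M ^ 2 * ε := by
    have : ∀ j ∈ Finset.range M, ∀ j' ∈ Finset.range M,
        c (max (j * (R + 1) * m) (j' * (R + 1) * m) - min (j * (R + 1) * m) (j' * (R + 1) * m))
          ≤ (if j = j' then 1 else 0) + ε := by
      intro j _ j' _
      have gap : ∀ a b : ℕ, a < b → R + 1 ≤ b * (R + 1) * m - a * (R + 1) * m := by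
        intro a b hab
        obtain ⟨e, rfl⟩ := Nat.exists_eq_add_of_lt hab
        rw [show (a + e + 1) * (R + 1) * m - a * (R + 1) * m = (e + 1) * (R + 1) * m by
          rw [Nat.sub_eq_iff_eq_add (by gcongr)]; ring]
        nlinarith [Nat.zero_le (e * (R + 1)), Nat.mul_le_mul hm (le_refl ((e + 1) * (R + 1)))]
      rcases lt_trichotomy j j' with h | h | h
      · rw [if_neg h.ne, zero_add, max_eq_right (by gcongr), min_eq_left (by gcongr)]
        exact hR _ (gap j j' h)
      · rw [if_pos h]
        linarith [c_le_one (max (j * (R + 1) * m) (j' * (R + 1) * m) -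
          min (j * (R + 1) * m) (j' * (R + 1) * m))]
      · rw [if_neg h.ne', zero_add, max_eq_left (by gcongr), min_eq_right (by gcongr)]
        exact hR _ (gap j' j h)
    refine (Finset.sum_le_sum fun j hj => Finset.sum_le_sum fun j' hj' => this j hj j' hj').trans ?_
    simp only [Finset.sum_add_distrib, Finset.sum_ite_eq, Finset.sum_const, Finset.card_range,
      nsmul_eq_mul]
    rw [Finset.sum_congr rfl fun j hj => if_pos hj]
    simp only [Finset.sum_const, Finset.card_range, nsmul_eq_mul]
    exact le_of_eq (by ring)
  have lim_sq : Tendsto (fun N : ℕ => (∑ n ∈ Finset.range N, S n ^ 2) / N) atTop (𝓝 V) := by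
    have := tendsto_finsetSum (Finset.range M) fun j _ => tendsto_finsetSum (Finset.range M)
      fun j' _ => tendsto_average_correlation hu hc (j * (R + 1) * m) (j' * (R + 1) * m)
    refine this.congr fun N => ?_
    simp_rw [← Finset.sum_div]
    congr 1
    simp_rw [hS, sq, Finset.sum_mul_sum]
    rw [Finset.sum_congr rfl fun j _ => Finset.sum_comm, Finset.sum_comm]
  have hNm : Tendsto (fun N : ℕ => N * m + r) atTop atTop :=
    tendsto_atTop_mono
      (fun N => (Nat.le_mul_of_pos_right N hm).trans (Nat.le_add_right _ _)) tendsto_id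
  have lim_ratio : Tendsto (fun N : ℕ => ((N * m + r : ℕ) : ℝ) / N) atTop (𝓝 m) := by
    have := (tendsto_const_div_atTop_nhds_zero_nat (r : ℝ)).const_add (m : ℝ)
    rw [add_zero] at this
    refine this.congr' ?_
    filter_upwards [eventually_ge_atTop 1] with N hN
    have : (N : ℝ) ≠ 0 := by positivity
    push_cast
    field_simp
  have lim_prog : Tendsto (fun N : ℕ => (∑ n ∈ Finset.range (N * m + r), S n ^ 2) / N)
      atTop (𝓝 (V * m)) := by
    refine ((lim_sq.comp hNm).mul lim_ratio).congr' ?_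
    filter_upwards [eventually_ge_atTop 1] with N hN
    have : ((N * m + r : ℕ) : ℝ) ≠ 0 := by
      have : 1 ≤ N * m := Nat.one_le_iff_ne_zero.2 (by positivity)
      exact_mod_cast (show N * m + r ≠ 0 by omega)
    simp only [Function.comp_apply]
    field_simp
  have V_lt : V * m < 3 * m * ε * M ^ 2 := by
    have : V ≤ 2 * (M ^ 2 * ε) := by linarith
    nlinarith [mul_pos hm' (mul_pos (pow_pos hM0 2) hε)]
  set K : ℝ := ∑ j ∈ Finset.range M, 2 * ((j * (R + 1) : ℕ) : ℝ) with hK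
  have hKlim := (tendsto_const_div_atTop_nhds_zero_nat K).eventually
    (gt_mem_nhds (show 0 < M * (δ / 2) by positivity))
  filter_upwards [lim_prog.eventually (gt_mem_nhds V_lt), hKlim, eventually_ge_atTop 1]
    with N h1 h2 h3
  have hN : (0 : ℝ) < N := by exact_mod_cast h3
  set A := ∑ i ∈ Finset.range N, u (i * m + r) with hA
  set B := ∑ i ∈ Finset.range N, S (i * m + r) with hB
  -- Along the progression each shift moves the index by `j * (R + 1)` and changes only boundary
  -- terms.
  have hBA : |B - M * A| ≤ K := by
    have e : B - M * A = ∑ j ∈ Finset.range M,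
        (∑ i ∈ Finset.range N, u ((i + j * (R + 1)) * m + r)
          - ∑ i ∈ Finset.range N, u (i * m + r)) := by
      rw [Finset.sum_sub_distrib, hB, Finset.sum_comm, Finset.sum_const, Finset.card_range,
        nsmul_eq_mul]
      congr 1
      refine Finset.sum_congr rfl fun j _ => Finset.sum_congr rfl fun i _ => ?_
      congr 1
      ring
    rw [e]
    refine (Finset.abs_sum_le_sum_abs _ _).trans (Finset.sum_le_sum fun j _ => ?_)
    exact abs_sum_range_shift_sub_le (v := fun i => u (i * m + r)) (fun i => hu _) _ _
  -- Cauchy–Schwarz, then enlargement of the progression to all integers below `N * m + r`: squares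
  -- are nonnegative, and the cost is only the factor `m` in the limit.
  have hB2 : (B / N) ^ 2 ≤ (∑ n ∈ Finset.range (N * m + r), S n ^ 2) / N := by
    have c1 : B ^ 2 ≤ N * ∑ i ∈ Finset.range N, S (i * m + r) ^ 2 := by
      simpa using sq_sum_le_card_mul_sum_sq (s := Finset.range N) (f := fun i => S (i * m + r))
    have c2 : ∑ i ∈ Finset.range N, S (i * m + r) ^ 2
        ≤ ∑ n ∈ Finset.range (N * m + r), S n ^ 2 := by
      have inj : Set.InjOn (fun i => i * m + r) (Finset.range N : Set ℕ) := fun i _ j _ hij =>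
        Nat.eq_of_mul_eq_mul_right hm (Nat.add_right_cancel hij)
      rw [← Finset.sum_image (f := fun n => S n ^ 2) inj]
      refine Finset.sum_le_sum_of_subset_of_nonneg (fun n hn => ?_) fun _ _ _ => sq_nonneg _
      obtain ⟨i, hi, rfl⟩ := Finset.mem_image.1 hn
      have := Nat.mul_lt_mul_of_pos_right (Finset.mem_range.1 hi) hm
      exact Finset.mem_range.2 (by omega)
    rw [div_pow, div_le_div_iff₀ (by positivity) hN]
    nlinarith [mul_le_mul_of_nonneg_left c2 hN.le]
  have hB3 : |B / N| ≤ M * (δ / 2) := by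
    refine abs_le_of_sq_le_sq (hB2.trans (h1.le.trans (le_of_eq ?_))) (by positivity)
    rw [hεδ]
    ring
  have hdiff : |B / N - M * (A / N)| < M * (δ / 2) := by
    rw [← mul_div_assoc, ← sub_div, abs_div, abs_of_pos hN]
    exact (div_le_div_of_nonneg_right hBA hN.le).trans_lt h2
  rw [Real.dist_eq, sub_zero]
  refine lt_of_mul_lt_mul_left (?_ : (M : ℝ) * |A / N| < M * δ) hM0.le
  rw [← abs_of_pos hM0, ← abs_mul, abs_of_pos hM0]
  rw [abs_lt] at hdiff ⊢
  rw [abs_le] at hB3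
  constructor <;> linarith [hdiff.1, hdiff.2, hB3.1, hB3.2]

/-! ### The transfer operator and monotone functions. -/

/-- The weight of the `k`-th inverse branch `x ↦ 1 / (k + 1 + x)` of the Gauss map in the
transfer operator relative to the Gauss measure. -/
noncomputable def gaussWeight (k : ℕ) (x : ℝ) : ℝ := (1 + x) / ((k + 1 + x) * (k + 2 + x))

/-- The transfer operator of the Gauss map relative to the Gauss measure, on `[0, 1]`. -/
noncomputable def gaussTransfer (f : ℝ → ℝ) : ℝ → ℝ :=
  (Icc (0 : ℝ) 1).indicator fun x => ∑' k : ℕ, gaussWeight k x * f (1 / (k + 1 + x))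

lemma gaussWeight_nonneg (k : ℕ) {x : ℝ} (hx : 0 ≤ x) : 0 ≤ gaussWeight k x := by
  unfold gaussWeight
  positivity

/-- The sum telescopes, since the weight is `(1 + x) * (1 / (k + 1 + x) - 1 / (k + 2 + x))`. -/
lemma hasSum_gaussWeight {x : ℝ} (hx : 0 ≤ x) : HasSum (fun k => gaussWeight k x) 1 := by
  rw [hasSum_iff_tendsto_nat_of_nonneg fun k => gaussWeight_nonneg k hx]
  have e : ∀ n : ℕ, ∑ k ∈ Finset.range n, gaussWeight k x = 1 - (1 + x) / (n + (1 + x)) := by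
    intro n
    induction n with
    | zero =>
      have : 1 + x ≠ 0 := by positivity
      simp [this]
    | succ n ih =>
      rw [Finset.sum_range_succ, ih, gaussWeight]
      have : (n : ℝ) + (1 + x) ≠ 0 := by positivity
      have : (n : ℝ) + 1 + x ≠ 0 := by positivity
      have : (n : ℝ) + 2 + x ≠ 0 := by positivity
      have : ((n + 1 : ℕ) : ℝ) + (1 + x) ≠ 0 := by positivity
      push_cast at *
      field_simp
      ring
  simp_rw [e]
  have : Tendsto (fun n : ℕ => (1 + x) / ((n : ℝ) + (1 + x))) atTop (𝓝 0) :=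
    tendsto_const_nhds.div_atTop
      (tendsto_atTop_add_const_right _ _ tendsto_natCast_atTop_atTop)
  simpa using this.const_sub 1

lemma one_div_branch_mem (k : ℕ) {x : ℝ} (hx : x ∈ Icc (0 : ℝ) 1) :
    1 / (k + 1 + x) ∈ Icc (0 : ℝ) 1 := by
  have h0 := hx.1
  have hk : (0 : ℝ) ≤ k := Nat.cast_nonneg k
  exact ⟨by positivity, by rw [div_le_one (by positivity)]; linarith⟩

section transfer

variable {f : ℝ → ℝ}

lemma hasSum_gaussTransfer (hf : MapsTo f (Icc 0 1) (Icc 0 1)) {x : ℝ} (hx : x ∈ Icc (0 : ℝ) 1) :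
    HasSum (fun k : ℕ => gaussWeight k x * f (1 / (k + 1 + x))) (gaussTransfer f x) := by
  rw [gaussTransfer, indicator_of_mem hx]
  refine (Summable.of_nonneg_of_le (fun k => ?_) (fun k => ?_)
    (hasSum_gaussWeight hx.1).summable).hasSum
  · exact mul_nonneg (gaussWeight_nonneg k hx.1) (hf (one_div_branch_mem k hx)).1
  · exact mul_le_of_le_one_right (gaussWeight_nonneg k hx.1) (hf (one_div_branch_mem k hx)).2

lemma mapsTo_gaussTransfer (hf : MapsTo f (Icc 0 1) (Icc 0 1)) :
    MapsTo (gaussTransfer f) (Icc 0 1) (Icc 0 1) := by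
  intro x hx
  refine ⟨(hasSum_gaussTransfer hf hx).nonneg fun k => ?_,
    hasSum_le (fun k => ?_) (hasSum_gaussTransfer hf hx) (hasSum_gaussWeight hx.1)⟩
  · exact mul_nonneg (gaussWeight_nonneg k hx.1) (hf (one_div_branch_mem k hx)).1
  · exact mul_le_of_le_one_right (gaussWeight_nonneg k hx.1) (hf (one_div_branch_mem k hx)).2

lemma measurable_gaussWeight (k : ℕ) : Measurable (gaussWeight k) := by
  unfold gaussWeight
  fun_prop

lemma measurable_gaussTransfer (hf : MapsTo f (Icc 0 1) (Icc 0 1)) (hm : Measurable f) :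
    Measurable (gaussTransfer f) := by
  refine measurable_of_tendsto_metrizable (f := fun n : ℕ => (Icc (0 : ℝ) 1).indicator
    fun x => ∑ k ∈ Finset.range n, gaussWeight k x * f (1 / (k + 1 + x))) (fun n => ?_) ?_
  · refine Measurable.indicator ?_ measurableSet_Icc
    refine Finset.measurable_fun_sum _ fun k _ => ?_
    have := measurable_gaussWeight k
    fun_prop
  · refine tendsto_pi_nhds.2 fun x => ?_
    by_cases hx : x ∈ Icc (0 : ℝ) 1
    · simp only [indicator_of_mem hx]
      exact (hasSum_gaussTransfer hf hx).tendsto_sum_nat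
    · simp [gaussTransfer, indicator_of_notMem hx]

lemma mapsTo_one_sub (hf : MapsTo f (Icc 0 1) (Icc 0 1)) :
    MapsTo (fun x => 1 - f x) (Icc (0 : ℝ) 1) (Icc 0 1) := fun x hx => by
  have := hf hx
  exact ⟨by linarith [this.2], by linarith [this.1]⟩

lemma gaussTransfer_one_sub (hf : MapsTo f (Icc 0 1) (Icc 0 1)) {x : ℝ}
    (hx : x ∈ Icc (0 : ℝ) 1) :
    gaussTransfer (fun x => 1 - f x) x = 1 - gaussTransfer f x := by
  refine (hasSum_gaussTransfer (mapsTo_one_sub hf) hx).unique ?_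
  simpa only [mul_sub, mul_one] using
    (hasSum_gaussWeight hx.1).sub (hasSum_gaussTransfer hf hx)

lemma gaussWeight_sub (k : ℕ) {x y : ℝ} (hx : 0 ≤ x) (hy : 0 ≤ y) :
    gaussWeight k x - gaussWeight k y = (y - x) * ((1 + x) * (1 + y) - k * (k + 1)) /
      (((k + 1 + x) * (k + 2 + x)) * ((k + 1 + y) * (k + 2 + y))) := by
  unfold gaussWeight
  have : (k : ℝ) + 1 + x ≠ 0 := by positivity
  have : (k : ℝ) + 2 + x ≠ 0 := by positivity
  have : (k : ℝ) + 1 + y ≠ 0 := by positivity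
  have : (k : ℝ) + 2 + y ≠ 0 := by positivity
  field_simp
  ring

/-- As `x` grows, each branch point decreases, and weight moves from `k = 0` to the branches `k ≥
2`, where an increasing `f` is smaller. The branch `k = 1`, whose weight may change either way, is
neutralised by the pivot. -/
lemma antitoneOn_gaussTransfer (hf : MapsTo f (Icc 0 1) (Icc 0 1))
    (hmono : MonotoneOn f (Icc 0 1)) : AntitoneOn (gaussTransfer f) (Icc 0 1) := by
  intro x hx y hy hxy
  have hx0 := hx.1
  have hy0 := hy.1
  have h1 := hasSum_gaussTransfer hf hx
  have h2 := hasSum_gaussTransfer hf hy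
  -- The weights sum to `1` at both points, so subtracting the constant `f (1 / (2 + x))` costs
  -- nothing and kills the term `k = 1`.
  have pivot : HasSum (fun k => (gaussWeight k x - gaussWeight k y) * f (1 / (1 + 1 + x))) 0 := by
    simpa using ((hasSum_gaussWeight hx0).sub (hasSum_gaussWeight hy0)).mul_right
      (f (1 / (1 + 1 + x)))
  refine sub_nonneg.1 (hasSum_le (fun k => ?_) pivot (h1.sub h2))
  have b1 : f (1 / (k + 1 + y)) ≤ f (1 / (k + 1 + x)) :=
    hmono (one_div_branch_mem k hy) (one_div_branch_mem k hx) (by gcongr)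
  have b2 := mul_le_mul_of_nonneg_left b1 (gaussWeight_nonneg k hy0)
  suffices 0 ≤ (gaussWeight k x - gaussWeight k y) *
      (f (1 / (k + 1 + x)) - f (1 / (1 + 1 + x))) by linarith
  have mem1 : 1 / (1 + 1 + x) ∈ Icc (0 : ℝ) 1 := by simpa using one_div_branch_mem 1 hx
  rw [gaussWeight_sub k hx0 hy0]
  rcases lt_trichotomy k 1 with hk | rfl | hk
  · obtain rfl : k = 0 := by omega
    refine mul_nonneg ?_ (sub_nonneg.2 (hmono mem1 (one_div_branch_mem 0 hx) ?_))
    · have := sub_nonneg.2 hxy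
      push_cast
      rw [zero_mul, sub_zero]
      positivity
    · push_cast
      gcongr
      norm_num
  · simp
  · have hk' : (2 : ℝ) ≤ k := by exact_mod_cast hk
    refine mul_nonneg_of_nonpos_of_nonpos ?_
      (sub_nonpos.2 (hmono (one_div_branch_mem k hx) mem1 ?_))
    · refine div_nonpos_of_nonpos_of_nonneg
        (mul_nonpos_of_nonneg_of_nonpos (sub_nonneg.2 hxy) ?_) (by positivity)
      nlinarith [hx.2, hy.2]
    · gcongr
      linarith

lemma monotoneOn_gaussTransfer (hf : MapsTo f (Icc 0 1) (Icc 0 1))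
    (hanti : AntitoneOn f (Icc 0 1)) : MonotoneOn (gaussTransfer f) (Icc 0 1) := by
  intro x hx y hy hxy
  have h := antitoneOn_gaussTransfer (mapsTo_one_sub hf)
    (fun a ha b hb hab => sub_le_sub_left (hanti ha hb hab) 1) hx hy hxy
  rw [gaussTransfer_one_sub hf hx, gaussTransfer_one_sub hf hy] at h
  linarith

/-- The branches at `0` with index `k + 1` reach the same points as the branches at `1` with index
`k`, with half the weight; the branch `k = 0` at `0` contributes `f 1 / 2`. -/
lemma gaussTransfer_zero (hf : MapsTo f (Icc 0 1) (Icc 0 1)) :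
    gaussTransfer f 0 = f 1 / 2 + gaussTransfer f 1 / 2 := by
  have h0 := hasSum_gaussTransfer hf (x := 0) (by simp)
  have h1 := (hasSum_gaussTransfer hf (x := 1) (by simp)).div_const 2
  rw [← hasSum_nat_add_iff' 1] at h0
  refine (sub_eq_iff_eq_add'.1 (h0.unique (a₂ := gaussTransfer f 1 / 2) ?_)).trans ?_
  · refine (congrArg (fun g => HasSum g _) (funext fun k => ?_)).mpr h1
    change gaussWeight (k + 1) 0 * f (1 / (((k + 1 : ℕ) : ℝ) + 1 + 0))
      = gaussWeight k 1 * f (1 / ((k : ℝ) + 1 + 1)) / 2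
    have : (k : ℝ) + 1 + 1 ≠ 0 := by positivity
    have : (k : ℝ) + 1 + 2 ≠ 0 := by positivity
    have : (k : ℝ) + 2 + 1 ≠ 0 := by positivity
    unfold gaussWeight
    push_cast
    simp only [add_zero]
    generalize f (1 / ((k : ℝ) + 1 + 1)) = c
    field_simp
    ring
  · simp [gaussWeight]
    ring

/-- Iterates of the transfer operator on a monotone function flatten exponentially fast. -/
lemma gaussTransfer_iterate_spread (hf : MapsTo f (Icc 0 1) (Icc 0 1))
    (h : MonotoneOn f (Icc 0 1) ∨ AntitoneOn f (Icc 0 1)) (n : ℕ) :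
    MapsTo (gaussTransfer^[n] f) (Icc 0 1) (Icc 0 1) ∧
    (MonotoneOn (gaussTransfer^[n] f) (Icc 0 1) ∨ AntitoneOn (gaussTransfer^[n] f) (Icc 0 1)) ∧
    |gaussTransfer^[n] f 0 - gaussTransfer^[n] f 1| ≤ (1 / 2) ^ n := by
  induction n with
  | zero =>
    have h0 := hf (x := 0) (by simp)
    have h1 := hf (x := 1) (by simp)
    refine ⟨hf, h, ?_⟩
    rw [pow_zero, Function.iterate_zero, id, abs_le]
    constructor <;> linarith [h0.1, h0.2, h1.1, h1.2]
  | succ n ih =>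
    obtain ⟨i1, i2, i3⟩ := ih
    rw [Function.iterate_succ_apply']
    refine ⟨mapsTo_gaussTransfer i1, i2.symm.imp (monotoneOn_gaussTransfer i1)
      (antitoneOn_gaussTransfer i1), ?_⟩
    set F := gaussTransfer^[n] f
    have m0 : (0 : ℝ) ∈ Icc (0 : ℝ) 1 := by simp
    have m1 : (1 : ℝ) ∈ Icc (0 : ℝ) 1 := by simp
    -- `gaussTransfer F 1` is a weighted average of values of `F`, hence lies between `F 0` and `F
    -- 1`. By `gaussTransfer_zero` the new gap is half of the left-hand side.
    have between : |F 1 - gaussTransfer F 1| ≤ |F 0 - F 1| := by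
      have hs := hasSum_gaussTransfer i1 m1
      have hw := (hasSum_gaussWeight zero_le_one)
      have l0 := hw.mul_right (F 0)
      have l1 := hw.mul_right (F 1)
      rw [one_mul] at l0 l1
      rcases i2 with hm | hm
      · have k0 := hasSum_le (fun k => mul_le_mul_of_nonneg_left (hm m0 (one_div_branch_mem k m1)
          (one_div_branch_mem k m1).1) (gaussWeight_nonneg k zero_le_one)) l0 hs
        have k1 := hasSum_le (fun k => mul_le_mul_of_nonneg_left (hm (one_div_branch_mem k m1) m1
          (one_div_branch_mem k m1).2) (gaussWeight_nonneg k zero_le_one)) hs l1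
        rw [abs_of_nonneg (by linarith), abs_of_nonpos (by linarith)]
        linarith
      · have k0 := hasSum_le (fun k => mul_le_mul_of_nonneg_left (hm m0 (one_div_branch_mem k m1)
          (one_div_branch_mem k m1).1) (gaussWeight_nonneg k zero_le_one)) hs l0
        have k1 := hasSum_le (fun k => mul_le_mul_of_nonneg_left (hm (one_div_branch_mem k m1) m1
          (one_div_branch_mem k m1).2) (gaussWeight_nonneg k zero_le_one)) l1 hs
        rw [abs_of_nonpos (by linarith), abs_of_nonneg (by linarith)]
        linarith
    rw [gaussTransfer_zero i1, show F 1 / 2 + gaussTransfer F 1 / 2 - gaussTransfer F 1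
      = (F 1 - gaussTransfer F 1) / 2 by ring, abs_div, abs_two, pow_succ]
    linarith

end transfer

/-! ### The Gauss measure: duality with the transfer operator, mixing and invariance. -/

lemma measurable_gaussMap : Measurable gaussMap := measurable_fract.comp measurable_inv

lemma gaussMap_branch (k : ℕ) {y : ℝ} (hy : y ∈ Ico (0 : ℝ) 1) :
    gaussMap (1 / (k + 1 + y)) = y := by
  rw [gaussMap, one_div, inv_inv, show (k : ℝ) + 1 + y = ((k + 1 : ℕ) : ℝ) + y by push_cast; ring,
    Int.fract_natCast_add, Int.fract_eq_self]
  exact hy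

lemma lintegral_gaussMeasure {G : ℝ → ENNReal} (hG : Measurable G) :
    ∫⁻ x, G x ∂gaussMeasure =
      ∫⁻ x in Ico (0 : ℝ) 1, ENNReal.ofReal (1 / ((1 + x) * Real.log 2)) * G x := by
  rw [gaussMeasure, lintegral_withDensity_eq_lintegral_mul _ (by fun_prop) hG]
  rfl

lemma ae_gaussMeasure_mem_Ico : ∀ᵐ x ∂gaussMeasure, x ∈ Ico (0 : ℝ) 1 :=
  (withDensity_absolutelyContinuous _ _).ae_le (ae_restrict_mem measurableSet_Ico)

lemma gaussMeasure_absolutelyContinuous : gaussMeasure ≪ volume :=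
  (withDensity_absolutelyContinuous _ _).trans Measure.absolutelyContinuous_restrict

lemma iUnion_branch_image :
    ⋃ k : ℕ, (fun y : ℝ => 1 / ((k : ℝ) + 1 + y)) '' Ico 0 1 = Ioc (0 : ℝ) 1 := by
  ext x
  simp only [mem_iUnion, mem_image]
  constructor
  · rintro ⟨k, y, hy, rfl⟩
    have := hy.1
    have hk : (0 : ℝ) ≤ k := Nat.cast_nonneg k
    exact ⟨by positivity, (one_div_branch_mem k ⟨hy.1, hy.2.le⟩).2⟩
  · intro hx
    have h1 : 1 ≤ x⁻¹ := (one_le_inv₀ hx.1).2 hx.2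
    have h2 : 1 ≤ ⌊x⁻¹⌋₊ := Nat.le_floor (by exact_mod_cast h1)
    have h3 := Nat.floor_le (zero_le_one.trans h1)
    have h4 := Nat.lt_floor_add_one x⁻¹
    refine ⟨⌊x⁻¹⌋₊ - 1, x⁻¹ - ⌊x⁻¹⌋₊, ⟨by linarith, by linarith⟩, ?_⟩
    rw [Nat.cast_sub h2]
    have : ((⌊x⁻¹⌋₊ : ℝ) - (1 : ℕ) + 1 + (x⁻¹ - ⌊x⁻¹⌋₊)) = x⁻¹ := by push_cast; ring
    rw [this, one_div, inv_inv]

lemma pairwise_disjoint_branch_image :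
    Pairwise (Function.onFun Disjoint
      fun k : ℕ => (fun y : ℝ => 1 / ((k : ℝ) + 1 + y)) '' Ico 0 1) := by
  intro i j hij
  refine Set.disjoint_left.2 ?_
  rintro x ⟨y, hy, rfl⟩ ⟨z, hz, hzy⟩
  have e : (j : ℝ) + 1 + z = i + 1 + y := by simpa using hzy
  apply hij
  have h1 : (i : ℝ) < j + 1 := by linarith [hy.1, hz.2]
  have h2 : (j : ℝ) < i + 1 := by linarith [hz.1, hy.2]
  have h1' : i < j + 1 := by exact_mod_cast h1
  have h2' : j < i + 1 := by exact_mod_cast h2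
  omega

/-- Change of variables on each inverse branch: the Gauss density at the branch point times the
absolute derivative of the branch is `gaussWeight` times the density at `y`. -/
lemma lintegral_gaussMeasure_eq_tsum {G : ℝ → ENNReal} (hG : Measurable G) :
    ∫⁻ x, G x ∂gaussMeasure =
      ∫⁻ y, ∑' k : ℕ, ENNReal.ofReal (gaussWeight k y) * G (1 / (k + 1 + y)) ∂gaussMeasure := by
  have hmeas : ∀ k : ℕ, Measurable fun y : ℝ =>
      ENNReal.ofReal (gaussWeight k y) * G (1 / ((k : ℝ) + 1 + y)) := fun k => by
    have := measurable_gaussWeight k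
    fun_prop
  have hderiv : ∀ k : ℕ, ∀ y ∈ Ico (0 : ℝ) 1, HasDerivWithinAt
      (fun y : ℝ => 1 / ((k : ℝ) + 1 + y)) (-1 / ((k : ℝ) + 1 + y) ^ 2) (Ico 0 1) y := by
    intro k y hy
    have : (k : ℝ) + 1 + y ≠ 0 := by
      have := hy.1
      positivity
    simp only [one_div]
    exact (((hasDerivAt_id y).const_add ((k : ℝ) + 1)).inv this).hasDerivWithinAt
  have hinj : ∀ k : ℕ, InjOn (fun y : ℝ => 1 / ((k : ℝ) + 1 + y)) (Ico 0 1) := by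
    intro k y _ z _ h
    simpa using h
  have himg : ∀ k : ℕ, MeasurableSet ((fun y : ℝ => 1 / ((k : ℝ) + 1 + y)) '' Ico 0 1) := fun k =>
    measurable_image_of_fderivWithin measurableSet_Ico
      (fun y hy => (hderiv k y hy).hasFDerivWithinAt) (hinj k)
  rw [lintegral_tsum fun k => (hmeas k).aemeasurable, lintegral_gaussMeasure hG,
    setLIntegral_congr Ico_ae_eq_Ioc, ← iUnion_branch_image,
    lintegral_iUnion himg pairwise_disjoint_branch_image]
  congr 1
  ext k
  rw [lintegral_gaussMeasure (hmeas k),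
    lintegral_image_eq_lintegral_abs_deriv_mul measurableSet_Ico (hderiv k) (hinj k)]
  refine setLIntegral_congr_fun measurableSet_Ico fun y hy => ?_
  have hy0 := hy.1
  have hk : (0 : ℝ) ≤ k := Nat.cast_nonneg k
  have hl : 0 < Real.log 2 := Real.log_pos one_lt_two
  rw [← mul_assoc, ← mul_assoc, ← ENNReal.ofReal_mul (abs_nonneg _),
    ← ENNReal.ofReal_mul (by positivity)]
  congr 2
  rw [neg_div, abs_neg, abs_of_pos (by positivity), gaussWeight]
  have : (k : ℝ) + 1 + y ≠ 0 := by positivity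
  have : (k : ℝ) + 2 + y ≠ 0 := by positivity
  have : 1 + y ≠ 0 := by positivity
  have : 1 + 1 / ((k : ℝ) + 1 + y) ≠ 0 := by positivity
  have : 1 + ((k : ℝ) + 1 + y) ≠ 0 := by positivity
  field_simp
  ring

lemma gaussMeasure_Ioo {a b : ℝ} (ha : 0 ≤ a) (hab : a ≤ b) (hb : b ≤ 1) :
    gaussMeasure (Ioo a b) = ENNReal.ofReal (Real.log ((1 + b) / (1 + a)) / Real.log 2) := by
  have hl : 0 < Real.log 2 := Real.log_pos one_lt_two
  have hd : ∀ x ∈ uIcc a b, HasDerivAt (fun x => Real.log (1 + x) / Real.log 2)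
      (1 / ((1 + x) * Real.log 2)) x := by
    intro x hx
    rw [uIcc_of_le hab] at hx
    have h0 : 1 + x ≠ 0 := by linarith [hx.1]
    rw [← div_div]
    exact (((hasDerivAt_id x).const_add 1).log h0).div_const (Real.log 2)
  have hc : ContinuousOn (fun x : ℝ => 1 / ((1 + x) * Real.log 2)) (uIcc a b) := by
    rw [uIcc_of_le hab]
    refine continuousOn_const.div (by fun_prop) fun x hx => ?_
    have : 0 < 1 + x := by linarith [hx.1]
    positivity
  have hint := intervalIntegral.integral_eq_sub_of_hasDerivAt hd hc.intervalIntegrable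
  have hIoo : Ioo a b ∩ Ico 0 1 = Ioo a b := by
    ext x
    simp only [mem_inter_iff, mem_Ioo, mem_Ico]
    constructor
    · exact fun h => h.1
    · exact fun h => ⟨h, by linarith, by linarith⟩
  rw [gaussMeasure, withDensity_apply _ measurableSet_Ioo, Measure.restrict_restrict
    measurableSet_Ioo, hIoo, ← ofReal_integral_eq_lintegral_ofReal,
    ← integral_Ioc_eq_integral_Ioo, ← intervalIntegral.integral_of_le hab, hint, ← sub_div,
    ← Real.log_div (by linarith) (by linarith)]
  · exact (hc.integrableOn_compact isCompact_uIcc).mono_set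
      (by rw [uIcc_of_le hab]; exact Ioo_subset_Icc_self)
  · filter_upwards [ae_restrict_mem measurableSet_Ioo] with x hx
    have : 0 < 1 + x := by linarith [hx.1]
    simp only [Pi.zero_apply]
    positivity

lemma gaussMeasure_compl_Ioo : gaussMeasure (Ioo 0 1)ᶜ = 0 := by
  have h1 : gaussMeasure (Ico 0 1)ᶜ = 0 := ae_gaussMeasure_mem_Ico
  have h2 : gaussMeasure {(0 : ℝ)} = 0 := gaussMeasure_absolutelyContinuous Real.volume_singleton
  refine measure_mono_null (fun x hx => ?_) (measure_union_null h1 h2)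
  by_contra h
  simp only [mem_union, mem_compl_iff, mem_Ico, mem_singleton_iff, not_or, not_not] at h
  exact hx ⟨lt_of_le_of_ne h.1.1 (Ne.symm h.2), h.1.2⟩

lemma ae_gaussMeasure_mem_Ioo : ∀ᵐ x ∂gaussMeasure, x ∈ Ioo (0 : ℝ) 1 := gaussMeasure_compl_Ioo

instance isProbabilityMeasure_gaussMeasure : IsProbabilityMeasure gaussMeasure := by
  refine ⟨?_⟩
  rw [← measure_add_measure_compl (measurableSet_Ioo (a := (0 : ℝ)) (b := 1)),
    gaussMeasure_compl_Ioo, gaussMeasure_Ioo le_rfl zero_le_one le_rfl]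
  have hl : Real.log 2 ≠ 0 := (Real.log_pos one_lt_two).ne'
  norm_num [hl]

section transfer

variable {f : ℝ → ℝ}

lemma integrable_of_mapsTo (hf : MapsTo f (Icc 0 1) (Icc 0 1)) (hm : Measurable f) :
    Integrable f gaussMeasure := by
  refine Integrable.of_bound hm.aestronglyMeasurable 1 ?_
  filter_upwards [ae_gaussMeasure_mem_Ioo] with x hx
  have := hf (Ioo_subset_Icc_self hx)
  rw [Real.norm_eq_abs, abs_of_nonneg this.1]
  exact this.2

lemma integral_gaussTransfer (hf : MapsTo f (Icc 0 1) (Icc 0 1)) (hm : Measurable f) :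
    ∫ x, gaussTransfer f x ∂gaussMeasure = ∫ x, f x ∂gaussMeasure := by
  have hf' := mapsTo_gaussTransfer hf
  rw [integral_eq_lintegral_of_nonneg_ae, integral_eq_lintegral_of_nonneg_ae,
    lintegral_gaussMeasure_eq_tsum (hm.ennreal_ofReal)]
  · congr 1
    refine lintegral_congr_ae ?_
    filter_upwards [ae_gaussMeasure_mem_Ioo] with x hx
    have hx' := Ioo_subset_Icc_self hx
    rw [← (hasSum_gaussTransfer hf hx').tsum_eq, ENNReal.ofReal_tsum_of_nonneg
      (fun k => mul_nonneg (gaussWeight_nonneg k hx'.1) (hf (one_div_branch_mem k hx')).1)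
      (hasSum_gaussTransfer hf hx').summable]
    congr 1
    ext k
    rw [ENNReal.ofReal_mul (gaussWeight_nonneg k hx'.1)]
  · filter_upwards [ae_gaussMeasure_mem_Ioo] with x hx using (hf (Ioo_subset_Icc_self hx)).1
  · exact hm.aestronglyMeasurable
  · filter_upwards [ae_gaussMeasure_mem_Ioo] with x hx using (hf' (Ioo_subset_Icc_self hx)).1
  · exact (measurable_gaussTransfer hf hm).aestronglyMeasurable

lemma mapsTo_indicator (hf : MapsTo f (Icc 0 1) (Icc 0 1)) (B : Set ℝ) :
    MapsTo (B.indicator f) (Icc 0 1) (Icc 0 1) := by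
  intro x hx
  by_cases h : x ∈ B
  · simpa [h] using hf hx
  · simp [h]

/-- Every branch point over `x` is mapped back to `x`, so the indicator of the preimage of `B` comes
out of the operator as the indicator of `B`. -/
lemma setIntegral_gaussTransfer (hf : MapsTo f (Icc 0 1) (Icc 0 1)) (hm : Measurable f)
    {B : Set ℝ} (hB : MeasurableSet B) :
    ∫ x in gaussMap ⁻¹' B, f x ∂gaussMeasure = ∫ x in B, gaussTransfer f x ∂gaussMeasure := by
  have hB' := measurable_gaussMap hB
  rw [← integral_indicator hB, ← integral_indicator hB',
    ← integral_gaussTransfer (mapsTo_indicator hf _) (hm.indicator hB')]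
  refine integral_congr_ae ?_
  filter_upwards [ae_gaussMeasure_mem_Ioo] with x hx
  have hx' := Ioo_subset_Icc_self hx
  refine (hasSum_gaussTransfer (mapsTo_indicator hf _) hx').unique ?_
  by_cases h : x ∈ B
  · rw [indicator_of_mem h]
    refine (congrArg (fun g => HasSum g _) (funext fun k => ?_)).mpr (hasSum_gaussTransfer hf hx')
    rw [indicator_of_mem]
    rwa [mem_preimage, gaussMap_branch k (Ioo_subset_Ico_self hx)]
  · rw [indicator_of_notMem h]
    refine (congrArg (fun g => HasSum g _) (funext fun k => ?_)).mpr hasSum_zero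
    rw [indicator_of_notMem, mul_zero]
    rwa [mem_preimage, gaussMap_branch k (Ioo_subset_Ico_self hx)]

lemma setIntegral_gaussTransfer_iterate (hf : MapsTo f (Icc 0 1) (Icc 0 1)) (hm : Measurable f)
    {B : Set ℝ} (hB : MeasurableSet B) (n : ℕ) :
    MapsTo (gaussTransfer^[n] f) (Icc 0 1) (Icc 0 1) ∧ Measurable (gaussTransfer^[n] f) ∧
    ∫ x in gaussMap^[n] ⁻¹' B, f x ∂gaussMeasure
      = ∫ x in B, gaussTransfer^[n] f x ∂gaussMeasure := by
  induction n generalizing B with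
  | zero => exact ⟨hf, hm, rfl⟩
  | succ n ih =>
    obtain ⟨h1, h2, -⟩ := ih hB
    rw [Function.iterate_succ_apply']
    refine ⟨mapsTo_gaussTransfer h1, measurable_gaussTransfer h1 h2, ?_⟩
    rw [← setIntegral_gaussTransfer h1 h2 hB, ← (ih (measurable_gaussMap hB)).2.2,
      ← preimage_comp, ← Function.iterate_succ']

/-- Exponential mixing of the Gauss map against a monotone observable. -/
lemma abs_setIntegral_sub_le (hf : MapsTo f (Icc 0 1) (Icc 0 1)) (hm : Measurable f)
    (h : MonotoneOn f (Icc 0 1) ∨ AntitoneOn f (Icc 0 1)) {B : Set ℝ} (hB : MeasurableSet B)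
    (n : ℕ) :
    |∫ x in gaussMap^[n] ⁻¹' B, f x ∂gaussMeasure
      - (∫ x, f x ∂gaussMeasure) * gaussMeasure.real B| ≤ (1 / 2) ^ n := by
  obtain ⟨-, hmono, hspread⟩ := gaussTransfer_iterate_spread hf h n
  obtain ⟨hF, hFm, hFB⟩ := setIntegral_gaussTransfer_iterate hf hm hB n
  have hFu := (setIntegral_gaussTransfer_iterate hf hm MeasurableSet.univ n).2.2
  rw [preimage_univ, setIntegral_univ, setIntegral_univ] at hFu
  rw [hFB, hFu]
  set F := gaussTransfer^[n] f
  -- A monotone function on `[0, 1]` lies between its endpoint values. Both quantities compared then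
  -- lie between `lo * μ(B)` and `hi * μ(B)`.
  obtain ⟨lo, hi, hd, hlo⟩ : ∃ lo hi, hi - lo ≤ (1 / 2) ^ n ∧
      ∀ x ∈ Icc (0 : ℝ) 1, lo ≤ F x ∧ F x ≤ hi := by
    have m0 : (0 : ℝ) ∈ Icc (0 : ℝ) 1 := by simp
    have m1 : (1 : ℝ) ∈ Icc (0 : ℝ) 1 := by simp
    rw [abs_le] at hspread
    rcases hmono with hm | hm
    · exact ⟨F 0, F 1, by linarith [hspread.1], fun x hx => ⟨hm m0 hx hx.1, hm hx m1 hx.2⟩⟩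
    · exact ⟨F 1, F 0, by linarith [hspread.2], fun x hx => ⟨hm hx m1 hx.2, hm m0 hx hx.1⟩⟩
  have hFi := integrable_of_mapsTo hF hFm
  have ae : ∀ᵐ x ∂gaussMeasure, lo ≤ F x ∧ F x ≤ hi := by
    filter_upwards [ae_gaussMeasure_mem_Ioo] with x hx using hlo x (Ioo_subset_Icc_self hx)
  have u1 : lo ≤ ∫ x, F x ∂gaussMeasure := by
    simpa using integral_mono_ae (integrable_const lo) hFi (ae.mono fun x hx => hx.1)
  have u2 : ∫ x, F x ∂gaussMeasure ≤ hi := by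
    simpa using integral_mono_ae hFi (integrable_const hi) (ae.mono fun x hx => hx.2)
  have v1 : gaussMeasure.real B * lo ≤ ∫ x in B, F x ∂gaussMeasure := by
    simpa using setIntegral_mono_ae (s := B) (integrable_const lo).integrableOn hFi.integrableOn
      (ae.mono fun x hx => hx.1)
  have v2 : ∫ x in B, F x ∂gaussMeasure ≤ gaussMeasure.real B * hi := by
    simpa using setIntegral_mono_ae (s := B) hFi.integrableOn (integrable_const hi).integrableOn
      (ae.mono fun x hx => hx.2)
  have b0 : 0 ≤ gaussMeasure.real B := measureReal_nonneg
  have b1 : gaussMeasure.real B ≤ 1 := measureReal_le_one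
  rw [abs_le]
  constructor <;> nlinarith

end transfer

lemma gaussTransfer_one {x : ℝ} (hx : x ∈ Icc (0 : ℝ) 1) : gaussTransfer (fun _ => 1) x = 1 := by
  refine (hasSum_gaussTransfer (fun x _ => by simp) hx).unique ?_
  simpa using hasSum_gaussWeight hx.1

lemma measurePreserving_gaussMap : MeasurePreserving gaussMap gaussMeasure gaussMeasure := by
  refine ⟨measurable_gaussMap, ?_⟩
  ext B hB
  rw [Measure.map_apply measurable_gaussMap hB]
  have h := setIntegral_gaussTransfer (f := fun _ => 1) (fun x _ => by simp) measurable_const hB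
  have e : ∫ x in B, gaussTransfer (fun _ => 1) x ∂gaussMeasure
      = ∫ x in B, (1 : ℝ) ∂gaussMeasure := by
    refine integral_congr_ae (ae_restrict_of_ae ?_)
    filter_upwards [ae_gaussMeasure_mem_Ioo] with x hx
      using gaussTransfer_one (Ioo_subset_Icc_self hx)
  rw [e] at h
  simpa [measureReal_def, ENNReal.toReal_eq_toReal_iff'] using h

lemma ae_iterate_gaussMap_mem_Ioo :
    ∀ᵐ x ∂gaussMeasure, ∀ i : ℕ, gaussMap^[i] x ∈ Ioo (0 : ℝ) 1 :=
  ae_all_iff.2 fun i =>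
    (measurePreserving_gaussMap.iterate i).quasiMeasurePreserving.ae ae_gaussMeasure_mem_Ioo

/-! ### The cylinders of the digit `1` and their correlations. -/

lemma cfDigit_zero_eq_one_iff {x : ℝ} (hx : 0 ≤ x) : cfDigit x 0 = 1 ↔ x ∈ Ioc (1 / 2 : ℝ) 1 := by
  rw [cfDigit, Function.iterate_zero, id]
  rcases hx.eq_or_lt with rfl | hx
  · norm_num
  · rw [Nat.floor_eq_iff (by positivity), Nat.cast_one, one_le_inv₀ hx, mem_Ioc, and_comm]
    refine and_congr_left fun _ => ?_
    rw [inv_lt_comm₀ hx (by norm_num)]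
    norm_num

lemma cfDigit_add (x : ℝ) (i j : ℕ) : cfDigit (gaussMap^[j] x) i = cfDigit x (i + j) := by
  rw [cfDigit, cfDigit, Function.iterate_add_apply]

lemma cfCylinder_one : cfCylinder [1] = Ioo (1 / 2) 1 := by
  ext x
  have : x ∈ cfCylinder [1] ↔ x ∈ Ico (0 : ℝ) 1 ∧ cfDigit x 0 = 1 := by
    simp [cfCylinder]
  rw [this]
  constructor
  · rintro ⟨h1, h2⟩
    exact ⟨((cfDigit_zero_eq_one_iff h1.1).1 h2).1, h1.2⟩
  · intro h
    have h0 : 0 ≤ x := by linarith [h.1]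
    exact ⟨⟨h0, h.2⟩, (cfDigit_zero_eq_one_iff h0).2 ⟨h.1, h.2.le⟩⟩

lemma cfCylinder_one_one : cfCylinder [1, 1] = Ioo (1 / 2) (2 / 3) := by
  ext x
  have : x ∈ cfCylinder [1, 1] ↔ (x ∈ Ico (0 : ℝ) 1 ∧ cfDigit x 0 = 1) ∧ cfDigit x 1 = 1 := by
    rw [and_assoc]
    refine and_congr_right fun _ => ⟨fun h => ⟨h 0 (by simp), h 1 (by simp)⟩, ?_⟩
    rintro ⟨h0, h1⟩ i hi
    have : i < 2 := hi
    interval_cases i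
    · exact h0
    · exact h1
  have map_eq : 1 / 2 < x → x < 1 → gaussMap x = x⁻¹ - 1 := by
    intro h1 h2
    have h0 : 0 < x := by linarith
    have a1 : 1 < x⁻¹ := (one_lt_inv₀ h0).2 h2
    have a2 : x⁻¹ < 2 := by rw [inv_lt_comm₀ h0 (by norm_num)]; linarith
    rw [gaussMap, Int.fract, show ⌊x⁻¹⌋ = 1 by
      rw [Int.floor_eq_iff]; push_cast; constructor <;> linarith]
    simp
  have key : 1 / 2 < x → x < 1 → (cfDigit x 1 = 1 ↔ x < 2 / 3) := by
    intro h1 h2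
    have h0 : 0 < x := by linarith
    have a1 : 1 < x⁻¹ := (one_lt_inv₀ h0).2 h2
    have a2 : x⁻¹ < 2 := by rw [inv_lt_comm₀ h0 (by norm_num)]; linarith
    have hd := cfDigit_add x 0 1
    rw [zero_add] at hd
    rw [← hd, Function.iterate_one, map_eq h1 h2, cfDigit_zero_eq_one_iff (by linarith)]
    have e : x < 2 / 3 ↔ 3 / 2 < x⁻¹ := by
      rw [lt_inv_comm₀ (by norm_num) h0]; norm_num
    rw [e]
    exact ⟨fun h => by linarith [h.1], fun h => ⟨by linarith, by linarith⟩⟩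
  rw [this]
  constructor
  · rintro ⟨⟨h1, h2⟩, h3⟩
    have h4 := ((cfDigit_zero_eq_one_iff h1.1).1 h2).1
    exact ⟨h4, (key h4 h1.2).1 h3⟩
  · intro h
    have h0 : 0 ≤ x := by linarith [h.1]
    have h1 : x < 1 := by linarith [h.2]
    exact ⟨⟨⟨h0, h1⟩, (cfDigit_zero_eq_one_iff h0).2 ⟨h.1, h1.le⟩⟩, (key h.1 h1).2 h.2⟩

lemma gaussMeasure_real_cfCylinder_one :
    gaussMeasure.real (cfCylinder [1]) = Real.log (4 / 3) / Real.log 2 := by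
  have hl : 0 < Real.log 2 := Real.log_pos one_lt_two
  have hn : 0 < Real.log (4 / 3) := Real.log_pos (by norm_num)
  rw [cfCylinder_one, measureReal_def, gaussMeasure_Ioo (by norm_num) (by norm_num) le_rfl,
    show ((1 : ℝ) + 1) / (1 + 1 / 2) = 4 / 3 by norm_num, ENNReal.toReal_ofReal (by positivity)]

lemma gaussMeasure_real_cfCylinder_one_one :
    gaussMeasure.real (cfCylinder [1, 1]) = Real.log (10 / 9) / Real.log 2 := by
  have hl : 0 < Real.log 2 := Real.log_pos one_lt_two
  have hn : 0 < Real.log (10 / 9) := Real.log_pos (by norm_num)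
  rw [cfCylinder_one_one, measureReal_def,
    gaussMeasure_Ioo (by norm_num) (by norm_num) (by norm_num),
    show ((1 : ℝ) + 2 / 3) / (1 + 1 / 2) = 10 / 9 by norm_num,
    ENNReal.toReal_ofReal (by positivity)]

lemma measurableSet_cfCylinder_one : MeasurableSet (cfCylinder [1]) := by
  rw [cfCylinder_one]
  exact measurableSet_Ioo

lemma branch_mem_cfCylinder_one_iff (k : ℕ) {y : ℝ} (hy : y ∈ Ioo (0 : ℝ) 1) :
    1 / ((k : ℝ) + 1 + y) ∈ cfCylinder [1] ↔ k = 0 := by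
  have hy0 := hy.1
  have hk : (0 : ℝ) ≤ k := Nat.cast_nonneg k
  rw [cfCylinder_one, mem_Ioo, div_lt_div_iff₀ (by norm_num) (by positivity),
    div_lt_one (by positivity)]
  constructor
  · rintro ⟨h, -⟩
    have : (k : ℝ) < 1 := by linarith
    have : k < 1 := by exact_mod_cast this
    omega
  · rintro rfl
    have := hy.2
    push_cast
    constructor <;> linarith

/-- Only the branch `k = 0` lands in the cylinder, and its weight is `1 / (2 + x)`. -/
lemma setIntegral_cfCylinder_one_inter {f : ℝ → ℝ} (hf : MapsTo f (Icc 0 1) (Icc 0 1))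
    (hm : Measurable f) {B : Set ℝ} (hB : MeasurableSet B) :
    ∫ x in cfCylinder [1] ∩ gaussMap ⁻¹' B, f x ∂gaussMeasure
      = ∫ x in B, 1 / (2 + x) * f (1 / (1 + x)) ∂gaussMeasure := by
  have hB' := measurable_gaussMap hB
  have hC := measurableSet_cfCylinder_one
  rw [inter_comm, ← setIntegral_indicator hC, setIntegral_gaussTransfer (mapsTo_indicator hf _)
    (hm.indicator hC) hB]
  refine integral_congr_ae (ae_restrict_of_ae ?_)
  filter_upwards [ae_gaussMeasure_mem_Ioo] with x hx
  have hx' := Ioo_subset_Icc_self hx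
  refine (hasSum_gaussTransfer (mapsTo_indicator hf _) hx').unique ?_
  have h := hasSum_single (f := fun k : ℕ => gaussWeight k x *
    (cfCylinder [1]).indicator f (1 / (k + 1 + x))) 0 fun k hk => by
      rw [indicator_of_notMem fun h => hk ((branch_mem_cfCylinder_one_iff k hx).1 h), mul_zero]
  rw [indicator_of_mem ((branch_mem_cfCylinder_one_iff 0 hx).2 rfl)] at h
  convert h using 1
  have : 1 + x ≠ 0 := by linarith [hx.1]
  have : 2 + x ≠ 0 := by linarith [hx.1]
  rw [gaussWeight, Nat.cast_zero, zero_add, zero_add]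
  field_simp

lemma mapsTo_one_div_two_add : MapsTo (fun x : ℝ => 1 / (2 + x)) (Icc 0 1) (Icc 0 1) := by
  intro x hx
  have := hx.1
  exact ⟨by positivity, by rw [div_le_one (by positivity)]; linarith⟩

lemma mapsTo_one_div_one_add : MapsTo (fun x : ℝ => 1 / (1 + x)) (Icc 0 1) (Icc 0 1) := by
  intro x hx
  have := hx.1
  exact ⟨by positivity, by rw [div_le_one (by positivity)]; linarith⟩

lemma measureReal_cfCylinder_one_inter {B : Set ℝ} (hB : MeasurableSet B) :
    gaussMeasure.real (cfCylinder [1] ∩ gaussMap ⁻¹' B)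
      = ∫ x in B, 1 / (2 + x) ∂gaussMeasure := by
  have h := setIntegral_cfCylinder_one_inter (f := fun _ => 1) (fun x _ => by simp)
    measurable_const hB
  simpa using h

lemma measureReal_iterate_preimage {B : Set ℝ} (hB : MeasurableSet B) (n : ℕ) :
    gaussMeasure.real (gaussMap^[n] ⁻¹' B) = gaussMeasure.real B :=
  (measurePreserving_gaussMap.iterate n).measureReal_preimage hB.nullMeasurableSet

lemma measurableSet_iterate_preimage {B : Set ℝ} (hB : MeasurableSet B) (n : ℕ) :
    MeasurableSet (gaussMap^[n] ⁻¹' B) := (measurable_gaussMap.iterate n) hB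

/-- Two digits `1` at distance at least two are more likely than two adjacent ones. -/
lemma measureReal_cfCylinder_one_one_lt {m : ℕ} (hm : 2 ≤ m) :
    gaussMeasure.real (cfCylinder [1, 1]) <
      gaussMeasure.real (cfCylinder [1] ∩ gaussMap^[m] ⁻¹' cfCylinder [1]) := by
  obtain ⟨j, rfl⟩ := Nat.exists_eq_add_of_le' hm
  have hC := measurableSet_cfCylinder_one
  have hint := integrable_of_mapsTo mapsTo_one_div_two_add (by fun_prop)
  have e : ∀ n : ℕ, gaussMeasure.real (cfCylinder [1] ∩ gaussMap^[n + 1] ⁻¹' cfCylinder [1])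
      = ∫ x in gaussMap^[n] ⁻¹' cfCylinder [1], 1 / (2 + x) ∂gaussMeasure := by
    intro n
    rw [Function.iterate_succ, preimage_comp,
      measureReal_cfCylinder_one_inter (measurableSet_iterate_preimage hC n)]
  -- Uses `1 / (2 + x) ≤ 1 / 2`.
  have upper : gaussMeasure.real (cfCylinder [1] ∩ gaussMap^[j + 1] ⁻¹' cfCylinder [1])
      ≤ 1 / 2 * gaussMeasure.real (cfCylinder [1]) := by
    rw [e]
    refine (setIntegral_mono_ae (g := fun _ => 1 / 2) hint.integrableOn
      (integrable_const _).integrableOn ?_).trans ?_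
    · filter_upwards [ae_gaussMeasure_mem_Ioo] with x hx
      exact one_div_le_one_div_of_le (by norm_num) (by linarith [hx.1])
    · rw [setIntegral_const, measureReal_iterate_preimage hC, smul_eq_mul, mul_comm]
  -- `1 / (2 + x)` is at least `2/5` for `x ≤ 1/2` and at least `1/3 = 2/5 - 1/15` on the cylinder.
  -- With `upper` this yields the factor `2/5 - 1/30 = 11/30`.
  have lower : 2 / 5 * gaussMeasure.real (cfCylinder [1])
      - 1 / 15 * gaussMeasure.real (cfCylinder [1] ∩ gaussMap^[j + 1] ⁻¹' cfCylinder [1])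
      ≤ gaussMeasure.real (cfCylinder [1] ∩ gaussMap^[j + 2] ⁻¹' cfCylinder [1]) := by
    have hi : Integrable ((cfCylinder [1]).indicator fun _ : ℝ => (1 / 15 : ℝ)) gaussMeasure :=
      (integrable_const _).indicator hC
    have h := setIntegral_mono_ae (s := gaussMap^[j + 1] ⁻¹' cfCylinder [1])
      (f := fun x => 2 / 5 - (cfCylinder [1]).indicator (fun _ => (1 / 15 : ℝ)) x)
      (g := fun x => 1 / (2 + x))
      ((integrable_const _).sub hi).integrableOn hint.integrableOn ?_
    · rw [integral_sub (integrable_const _) hi.integrableOn, setIntegral_const,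
        measureReal_iterate_preimage hC, setIntegral_indicator hC, setIntegral_const,
        smul_eq_mul, smul_eq_mul, inter_comm] at h
      rw [e (j + 1)]
      linarith
    · filter_upwards [ae_gaussMeasure_mem_Ioo] with x hx
      have h0 := hx.1
      by_cases hx1 : x ∈ cfCylinder [1]
      · rw [indicator_of_mem hx1, le_div_iff₀ (by positivity)]
        linarith [hx.2]
      · rw [indicator_of_notMem hx1, le_div_iff₀ (by positivity)]
        rw [cfCylinder_one] at hx1
        have : x ≤ 1 / 2 := not_lt.1 fun h => hx1 ⟨h, hx.2⟩
        linarith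
  have numeric : 30 * Real.log (10 / 9) < 11 * Real.log (4 / 3) := by
    have h : Real.log ((10 / 9) ^ 30) < Real.log ((4 / 3) ^ 11) :=
      Real.log_lt_log (by positivity) (by norm_num)
    rw [Real.log_pow, Real.log_pow] at h
    exact_mod_cast h
  have main : gaussMeasure.real (cfCylinder [1, 1])
      < 11 / 30 * gaussMeasure.real (cfCylinder [1]) := by
    have hl : 0 < Real.log 2 := Real.log_pos one_lt_two
    rw [gaussMeasure_real_cfCylinder_one, gaussMeasure_real_cfCylinder_one_one,
      ← mul_div_assoc, div_lt_div_iff_of_pos_right hl]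
    linarith
  linarith

/-- Mixing of the Gauss map for the event that the digits at positions `0` and `m` are `1`. -/
lemma abs_measureReal_two_ones_sub_le {m : ℕ} (hm : 1 ≤ m) {B : Set ℝ} (hB : MeasurableSet B)
    (n : ℕ) :
    |gaussMeasure.real ((cfCylinder [1] ∩ gaussMap^[m] ⁻¹' cfCylinder [1]) ∩
        gaussMap^[n + m + 1] ⁻¹' B)
      - gaussMeasure.real (cfCylinder [1] ∩ gaussMap^[m] ⁻¹' cfCylinder [1])
        * gaussMeasure.real B| ≤ 2 * (1 / 2) ^ n := by
  obtain ⟨j, rfl⟩ := Nat.exists_eq_add_of_le' hm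
  have hC := measurableSet_cfCylinder_one
  have hg : Measurable fun x : ℝ => 1 / (2 + x) := by fun_prop
  have ganti : AntitoneOn (fun x : ℝ => 1 / (2 + x)) (Icc 0 1) := fun x hx y _ hxy =>
    one_div_le_one_div_of_le (by linarith [hx.1]) (by linarith)
  have banti : AntitoneOn (fun x : ℝ => 1 / (1 + x)) (Icc 0 1) := fun x hx y _ hxy =>
    one_div_le_one_div_of_le (by linarith [hx.1]) (by linarith)
  obtain ⟨hh, hhmono, -⟩ := gaussTransfer_iterate_spread mapsTo_one_div_two_add (Or.inr ganti) j
  have hhm := (setIntegral_gaussTransfer_iterate mapsTo_one_div_two_add hg hC j).2.1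
  set h := gaussTransfer^[j] fun x : ℝ => 1 / (2 + x) with h_def
  -- The transfer operator is applied through the first digit, the `j` free digits and the second
  -- prescribed digit in turn, leaving an explicit density on `D`.
  have formula : ∀ D : Set ℝ, MeasurableSet D →
      gaussMeasure.real ((cfCylinder [1] ∩ gaussMap^[j + 1] ⁻¹' cfCylinder [1]) ∩
        gaussMap^[j + 2] ⁻¹' D) = ∫ x in D, 1 / (2 + x) * h (1 / (1 + x)) ∂gaussMeasure := by
    intro D hD
    have hCD : MeasurableSet (cfCylinder [1] ∩ gaussMap ⁻¹' D) :=
      hC.inter (measurable_gaussMap hD)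
    rw [← setIntegral_cfCylinder_one_inter hh hhm hD, h_def,
      ← (setIntegral_gaussTransfer_iterate mapsTo_one_div_two_add hg hCD j).2.2,
      ← measureReal_cfCylinder_one_inter (measurableSet_iterate_preimage hCD j),
      ← preimage_comp, ← Function.iterate_succ, preimage_inter, ← preimage_comp,
      ← Function.iterate_succ', inter_assoc]
  set H : ℝ → ℝ := fun x => h (1 / (1 + x)) with H_def
  have hH : MapsTo H (Icc 0 1) (Icc 0 1) := hh.comp mapsTo_one_div_one_add
  have hHm : Measurable H := hhm.comp (by fun_prop)
  have hφ : MapsTo (fun x => 1 / (2 + x) * H x) (Icc (0 : ℝ) 1) (Icc 0 1) := fun x hx =>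
    ⟨mul_nonneg (mapsTo_one_div_two_add hx).1 (hH hx).1,
      mul_le_one₀ (mapsTo_one_div_two_add hx).2 (hH hx).1 (hH hx).2⟩
  have hφm : Measurable fun x => 1 / (2 + x) * H x := hg.mul hHm
  have mean : gaussMeasure.real (cfCylinder [1] ∩ gaussMap^[j + 1] ⁻¹' cfCylinder [1])
      = ∫ x, 1 / (2 + x) * H x ∂gaussMeasure := by
    have := formula univ MeasurableSet.univ
    rwa [preimage_univ, inter_univ, setIntegral_univ] at this
  have e : gaussMap^[n + (j + 1) + 1] ⁻¹' B = gaussMap^[j + 2] ⁻¹' (gaussMap^[n] ⁻¹' B) := by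
    rw [← preimage_comp, ← Function.iterate_add]
    rfl
  rw [e, formula _ (measurableSet_iterate_preimage hB n), mean]
  change |∫ x in gaussMap^[n] ⁻¹' B, 1 / (2 + x) * H x ∂gaussMeasure - _| ≤ _
  rcases hhmono with hmono | hanti
  · have Hanti : AntitoneOn H (Icc 0 1) := fun x hx y hy hxy =>
      hmono (mapsTo_one_div_one_add hy) (mapsTo_one_div_one_add hx) (banti hx hy hxy)
    have hφanti : AntitoneOn (fun x => 1 / (2 + x) * H x) (Icc (0 : ℝ) 1) :=
      fun x hx y hy hxy => mul_le_mul (ganti hx hy hxy) (Hanti hx hy hxy) (hH hy).1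
        (mapsTo_one_div_two_add hx).1
    refine (abs_setIntegral_sub_le hφ hφm (Or.inr hφanti) hB n).trans ?_
    linarith [show (0 : ℝ) ≤ (1 / 2) ^ n by positivity]
  · have Hmono : MonotoneOn H (Icc 0 1) := fun x hx y hy hxy =>
      hanti (mapsTo_one_div_one_add hy) (mapsTo_one_div_one_add hx) (banti hx hy hxy)
    -- Here the factors of the density have opposite monotonicity; it is written as a difference of
    -- two increasing functions, which accounts for the constant `2`.
    have cmaps := mapsTo_one_sub mapsTo_one_div_two_add
    have hψ : MapsTo (fun x => (1 - 1 / (2 + x)) * H x) (Icc (0 : ℝ) 1) (Icc 0 1) := fun x hx =>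
      ⟨mul_nonneg (cmaps hx).1 (hH hx).1, mul_le_one₀ (cmaps hx).2 (hH hx).1 (hH hx).2⟩
    have hψm : Measurable fun x => (1 - 1 / (2 + x)) * H x := (hg.const_sub 1).mul hHm
    have hψmono : MonotoneOn (fun x => (1 - 1 / (2 + x)) * H x) (Icc (0 : ℝ) 1) :=
      fun x hx y hy hxy => mul_le_mul (sub_le_sub_left (ganti hx hy hxy) 1) (Hmono hx hy hxy)
        (hH hx).1 (cmaps hy).1
    have b1 := abs_setIntegral_sub_le hH hHm (Or.inl Hmono) hB n
    have b2 := abs_setIntegral_sub_le hψ hψm (Or.inl hψmono) hB n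
    have iH := integrable_of_mapsTo hH hHm
    have iψ := integrable_of_mapsTo hψ hψm
    have split : ∀ x, 1 / (2 + x) * H x = H x - (1 - 1 / (2 + x)) * H x := fun x => by ring
    simp_rw [split]
    rw [integral_sub iH iψ, integral_sub iH.integrableOn iψ.integrableOn]
    rw [abs_le] at *
    constructor <;> linarith [b1.1, b1.2, b2.1, b2.2]

/-! ### From CF-normality to frequencies of patterns of ones. -/

lemma ite_one_zero_congr {p q : Prop} {_ : Decidable p} {_ : Decidable q} (h : p ↔ q) :
    (if p then (1 : ℝ) else 0) = if q then 1 else 0 := if_congr h rfl rfl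

open Classical in
lemma ncard_le_eq_sum (P : ℕ → Prop) (n : ℕ) :
    ({i : ℕ | i ≤ n ∧ P i}.ncard : ℝ) = ∑ i ∈ Finset.range (n + 1), if P i then (1 : ℝ) else 0 := by
  rw [show {i : ℕ | i ≤ n ∧ P i} = ((Finset.range (n + 1)).filter P : Set ℕ) by
    ext i; simp, ncard_coe_finset, Finset.sum_boole]

lemma HasCFValue.iterate_mem_cfCylinder_iff {d : ℕ → ℕ+} {x : ℝ} (h : HasCFValue d x) (n : ℕ)
    (s : List ℕ+) :
    gaussMap^[n] x ∈ cfCylinder s ↔ ∀ (i : ℕ) (hi : i < s.length), d (n + i) = s[i] := by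
  have hm := (h.iterate n).mem_Ioo
  rw [cfCylinder, mem_ofPred_eq, and_iff_right ⟨hm.1.le, hm.2⟩]
  refine forall₂_congr fun i hi => ?_
  rw [(h.iterate n).cfDigit_eq, add_comm, PNat.coe_inj]

lemma HasCFValue.iterate_mem_cfCylinder_ofFn_iff {d : ℕ → ℕ+} {x : ℝ} (h : HasCFValue d x)
    (n : ℕ) {L : ℕ} {s : Fin L → ℕ+} :
    gaussMap^[n] x ∈ cfCylinder (List.ofFn s) ↔ (fun i : Fin L => d (n + i)) = s := by
  rw [h.iterate_mem_cfCylinder_iff, funext_iff]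
  refine ⟨fun hn i => ?_, fun hn i hi => ?_⟩
  · simpa using hn i (by simp)
  · have hi' : i < L := by simpa using hi
    simpa using hn ⟨i, hi'⟩

open Classical in
lemma CFNormal.tendsto_average {x : ℝ} (hx : CFNormal x) {s : List ℕ+} (hs : s ≠ []) :
    Tendsto (fun N : ℕ => (∑ n ∈ Finset.range N,
      if gaussMap^[n] x ∈ cfCylinder s then (1 : ℝ) else 0) / N)
      atTop (𝓝 (gaussMeasure.real (cfCylinder s))) := by
  have h := hx.2 s hs
  simp_rw [ncard_le_eq_sum] at h
  -- The definition of CF-normality counts the `n + 1` indices `0, …, n` but divides by `n`; the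
  -- extra term is negligible.
  have h0 : Tendsto (fun N : ℕ => (if gaussMap^[N] x ∈ cfCylinder s then (1 : ℝ) else 0) / N)
      atTop (𝓝 0) := by
    refine squeeze_zero (fun N => by positivity) (fun N => ?_)
      (tendsto_const_div_atTop_nhds_zero_nat 1)
    refine div_le_div_of_nonneg_right ?_ (Nat.cast_nonneg N)
    split_ifs <;> norm_num
  have := h.sub h0
  rw [sub_zero] at this
  refine this.congr fun N => ?_
  rw [← sub_div, Finset.sum_range_succ, add_sub_cancel_right]

lemma mem_cfCylinder_ofFn {L : ℕ} {s : Fin L → ℕ+} {y : ℝ} :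
    y ∈ cfCylinder (List.ofFn s) ↔ y ∈ Ico (0 : ℝ) 1 ∧ ∀ i : Fin L, cfDigit y i = s i := by
  refine and_congr_right fun _ => ⟨fun h i => ?_, fun h i hi => ?_⟩
  · simpa using h i (by simp)
  · have hi' : i < L := by simpa using hi
    simpa using h ⟨i, hi'⟩

lemma measurable_cfDigit (i : ℕ) : Measurable fun x => cfDigit x i :=
  Nat.measurable_floor.comp (measurable_gaussMap.iterate i).inv

lemma measurableSet_cfCylinder_ofFn {L : ℕ} (s : Fin L → ℕ+) :
    MeasurableSet (cfCylinder (List.ofFn s)) := by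
  have : cfCylinder (List.ofFn s) = Ico 0 1 ∩ ⋂ i : Fin L, {y | cfDigit y i = s i} := by
    ext y
    rw [mem_cfCylinder_ofFn]
    simp
  rw [this]
  exact measurableSet_Ico.inter (MeasurableSet.iInter fun i =>
    measurable_cfDigit i (measurableSet_singleton _))

lemma disjoint_cfCylinder_ofFn {L : ℕ} {s t : Fin L → ℕ+} (hst : s ≠ t) :
    Disjoint (cfCylinder (List.ofFn s)) (cfCylinder (List.ofFn t)) := by
  refine Set.disjoint_left.2 fun y hs ht => hst (funext fun i => ?_)
  rw [mem_cfCylinder_ofFn] at hs ht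
  exact PNat.coe_inj.1 ((hs.2 i).symm.trans (ht.2 i))

lemma hasSum_indicator_cfCylinder {L : ℕ} (W : Set (Fin L → ℕ+)) :
    HasSum (W.indicator fun s => gaussMeasure.real (cfCylinder (List.ofFn s)))
      (gaussMeasure.real (⋃ s ∈ W, cfCylinder (List.ofFn s))) := by
  have h := measure_biUnion (μ := gaussMeasure) (s := W) (f := fun s => cfCylinder (List.ofFn s))
    (to_countable W) (fun s _ t _ hst => disjoint_cfCylinder_ofFn hst)
    fun s _ => measurableSet_cfCylinder_ofFn s
  rw [← hasSum_subtype_iff_indicator, measureReal_def, h, ENNReal.tsum_toReal_eq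
    fun s => measure_ne_top _ _]
  exact ENNReal.hasSum_toReal (by rw [← h]; exact measure_ne_top _ _)

lemma exists_mem_cfCylinder_ofFn {y : ℝ} (hy : ∀ i, gaussMap^[i] y ∈ Ioo (0 : ℝ) 1) (L : ℕ) :
    ∃ s : Fin L → ℕ+, y ∈ cfCylinder (List.ofFn s) := by
  have pos : ∀ i, 0 < cfDigit y i := fun i =>
    Nat.floor_pos.2 ((one_le_inv₀ (hy i).1).2 (hy i).2.le)
  exact ⟨fun i => ⟨cfDigit y i, pos i⟩,
    mem_cfCylinder_ofFn.2 ⟨Ioo_subset_Ico_self (hy 0), fun i => rfl⟩⟩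

/-- In a CF-normal expansion, digits `1` occur simultaneously at a finite pattern of positions
with the frequency predicted by the Gauss measure. -/
lemma tendsto_frequency_ones {d : ℕ → ℕ+} {x : ℝ} (h : HasCFValue d x) (hx : CFNormal x)
    (J : Finset ℕ) :
    Tendsto (fun N : ℕ => (∑ n ∈ Finset.range N, if ∀ j ∈ J, d (n + j) = 1 then (1 : ℝ) else 0) / N)
      atTop (𝓝 (gaussMeasure.real {y | ∀ j ∈ J, gaussMap^[j] y ∈ cfCylinder [1]})) := by
  classical
  set L := J.sup id + 1 with hL
  have hJ : ∀ j ∈ J, j < L := fun j hj => Nat.lt_succ_of_le (Finset.le_sup (f := id) hj)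
  -- Digits at positions outside `J` are free, so `W` is in general infinite and finite additivity
  -- of frequencies would not suffice.
  set W : Set (Fin L → ℕ+) := {s | ∀ j (hj : j ∈ J), s ⟨j, hJ j hj⟩ = 1} with hW
  have total : gaussMeasure.real (⋃ s ∈ (univ : Set (Fin L → ℕ+)), cfCylinder (List.ofFn s))
      = 1 := by
    rw [measureReal_congr (t := univ), probReal_univ]
    rw [eventuallyEq_univ]
    filter_upwards [ae_iterate_gaussMap_mem_Ioo] with y hy
    obtain ⟨s, hs⟩ := exists_mem_cfCylinder_ofFn hy L
    exact mem_biUnion (mem_univ s) hs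
  have hsum := hasSum_indicator_cfCylinder (univ : Set (Fin L → ℕ+))
  rw [total, indicator_univ] at hsum
  have event : gaussMeasure.real (⋃ s ∈ W, cfCylinder (List.ofFn s))
      = gaussMeasure.real {y | ∀ j ∈ J, gaussMap^[j] y ∈ cfCylinder [1]} := by
    refine measureReal_congr ?_
    filter_upwards [ae_iterate_gaussMap_mem_Ioo] with y hy
    refine propext ?_
    change y ∈ ⋃ s ∈ W, cfCylinder (List.ofFn s) ↔ ∀ j ∈ J, gaussMap^[j] y ∈ cfCylinder [1]
    have one_iff : ∀ j, gaussMap^[j] y ∈ cfCylinder [1] ↔ cfDigit y j = 1 := by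
      intro j
      rw [← zero_add j, ← cfDigit_add, zero_add, cfDigit_zero_eq_one_iff (hy j).1.le,
        cfCylinder_one]
      exact ⟨fun h => ⟨h.1, h.2.le⟩, fun h => ⟨h.1, (hy j).2⟩⟩
    obtain ⟨s, hs⟩ := exists_mem_cfCylinder_ofFn hy L
    have hs' := (mem_cfCylinder_ofFn.1 hs).2
    have hsW : y ∈ ⋃ s ∈ W, cfCylinder (List.ofFn s) ↔ s ∈ W := by
      rw [mem_iUnion₂]
      refine ⟨?_, fun h => ⟨s, h, hs⟩⟩
      rintro ⟨t, ht, hyt⟩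
      by_contra hc
      exact Set.disjoint_left.1 (disjoint_cfCylinder_ofFn fun e : s = t => hc (e ▸ ht)) hs hyt
    rw [hsW]
    refine forall₂_congr fun j hj => ?_
    rw [one_iff, hs' ⟨j, hJ j hj⟩, ← PNat.coe_inj, PNat.one_coe]
  have key := tendsto_frequency_of_countable (fun n (i : Fin L) => d (n + i))
    (fun s => gaussMeasure.real (cfCylinder (List.ofFn s))) hsum (fun s => measureReal_nonneg)
    (fun s => by
      refine (hx.tendsto_average (s := List.ofFn s) (by simp [hL])).congr fun N => ?_
      congr 1
      refine Finset.sum_congr rfl fun n _ => ite_one_zero_congr ?_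
      exact h.iterate_mem_cfCylinder_ofFn_iff n) W
  rw [(hasSum_indicator_cfCylinder W).tsum_eq, event] at key
  refine key.congr fun N => ?_
  congr 1
  exact Finset.sum_congr rfl fun n _ => ite_one_zero_congr Iff.rfl

/-! ### Pairs of ones along a progression, and the theorem. -/

lemma measureReal_pair_correlation_tendsto {m : ℕ} (hm : 1 ≤ m) :
    Tendsto (fun h : ℕ =>
      gaussMeasure.real ((cfCylinder [1] ∩ gaussMap^[m] ⁻¹' cfCylinder [1]) ∩
        gaussMap^[h] ⁻¹' (cfCylinder [1] ∩ gaussMap^[m] ⁻¹' cfCylinder [1]))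
      - gaussMeasure.real (cfCylinder [1] ∩ gaussMap^[m] ⁻¹' cfCylinder [1]) ^ 2)
      atTop (𝓝 0) := by
  rw [← tendsto_add_atTop_iff_nat (m + 1)]
  have lim : Tendsto (fun n : ℕ => 2 * (1 / 2 : ℝ) ^ n) atTop (𝓝 0) := by
    simpa using (tendsto_pow_atTop_nhds_zero_of_lt_one (by norm_num : (0 : ℝ) ≤ 1 / 2)
      (by norm_num)).const_mul 2
  refine squeeze_zero_norm (fun n => ?_) lim
  rw [sq, ← add_assoc]
  exact abs_measureReal_two_ones_sub_le hm (measurableSet_cfCylinder_one.inter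
    (measurableSet_iterate_preimage measurableSet_cfCylinder_one m)) n

/-- In a CF-normal expansion, the pairs of digits at distance `m` starting at an arithmetic
progression of difference `m` are both `1` with the frequency predicted by the Gauss measure. -/
lemma tendsto_frequency_ones_progression {d : ℕ → ℕ+} {x : ℝ} (h : HasCFValue d x)
    (hx : CFNormal x) {m : ℕ} (hm : 1 ≤ m) (r : ℕ) :
    Tendsto (fun N : ℕ => (∑ i ∈ Finset.range N,
      if d (i * m + r) = 1 ∧ d ((i + 1) * m + r) = 1 then (1 : ℝ) else 0) / N) atTop
      (𝓝 (gaussMeasure.real (cfCylinder [1] ∩ gaussMap^[m] ⁻¹' cfCylinder [1]))) := by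
  set E := cfCylinder [1] ∩ gaussMap^[m] ⁻¹' cfCylinder [1] with hE
  set p := gaussMeasure.real E with hp
  have p0 : 0 ≤ p := measureReal_nonneg
  have p1 : p ≤ 1 := measureReal_le_one
  set v : ℕ → ℝ := fun n => if d n = 1 ∧ d (n + m) = 1 then (1 : ℝ) else 0 with hv
  have v_bound : ∀ n, |v n| ≤ 1 := fun n => by simp only [hv]; split_ifs <;> simp
  have u_bound : ∀ n, |v n - p| ≤ 1 := fun n => by
    rw [abs_le]
    simp only [hv]
    split_ifs <;> constructor <;> linarith
  have const : Tendsto (fun N : ℕ => (∑ n ∈ Finset.range N, p) / N) atTop (𝓝 p) := by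
    refine tendsto_const_nhds.congr' ?_
    filter_upwards [eventually_ge_atTop 1] with N hN
    have : (N : ℝ) ≠ 0 := by positivity
    rw [Finset.sum_const, Finset.card_range, nsmul_eq_mul]
    field_simp
  have freq : Tendsto (fun N : ℕ => (∑ n ∈ Finset.range N, v n) / N) atTop (𝓝 p) := by
    have := tendsto_frequency_ones h hx {0, m}
    rw [show {y | ∀ j ∈ ({0, m} : Finset ℕ), gaussMap^[j] y ∈ cfCylinder [1]} = E by
      ext y; simp [hE]] at this
    refine this.congr fun N => ?_
    simp [hv]
  have freq_pair : ∀ l, Tendsto (fun N : ℕ => (∑ n ∈ Finset.range N, v n * v (n + l)) / N) atTop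
      (𝓝 (gaussMeasure.real (E ∩ gaussMap^[l] ⁻¹' E))) := by
    intro l
    -- Positions may coincide, for instance when `l = 0` or `l = m`; the condition over the finset
    -- is insensitive to this.
    have := tendsto_frequency_ones h hx {0, m, l, m + l}
    rw [show {y | ∀ j ∈ ({0, m, l, m + l} : Finset ℕ), gaussMap^[j] y ∈ cfCylinder [1]}
      = E ∩ gaussMap^[l] ⁻¹' E by
        ext y; simp [hE, Function.iterate_add_apply, and_assoc]; tauto] at this
    refine this.congr fun N => ?_
    congr 1
    refine Finset.sum_congr rfl fun n _ => ?_
    simp only [hv]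
    rw [ite_zero_mul_ite_zero, one_mul]
    refine ite_one_zero_congr ?_
    simp only [Finset.mem_insert, Finset.mem_singleton, forall_eq_or_imp, forall_eq, add_zero,
      and_assoc, add_assoc, add_comm m l]
  have corr : ∀ l, Tendsto (fun N : ℕ =>
      (∑ n ∈ Finset.range N, (v n - p) * (v (n + l) - p)) / N) atTop
      (𝓝 (gaussMeasure.real (E ∩ gaussMap^[l] ⁻¹' E) - p ^ 2)) := by
    intro l
    have := (((freq_pair l).sub (freq.const_mul p)).sub
      ((tendsto_average_shift v_bound l freq).const_mul p)).add (const.const_mul p)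
    rw [show gaussMeasure.real (E ∩ gaussMap^[l] ⁻¹' E) - p * p - p * p + p * p
      = gaussMeasure.real (E ∩ gaussMap^[l] ⁻¹' E) - p ^ 2 by ring] at this
    refine this.congr fun N => ?_
    rw [← mul_div_assoc, ← mul_div_assoc, ← mul_div_assoc, ← sub_div, ← sub_div, ← add_div,
      Finset.mul_sum, Finset.mul_sum, Finset.mul_sum, ← Finset.sum_sub_distrib,
      ← Finset.sum_sub_distrib, ← Finset.sum_add_distrib]
    congr 1
    exact Finset.sum_congr rfl fun n _ => by ring
  have main := (tendsto_average_arithmetic_progression u_bound corr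
    (measureReal_pair_correlation_tendsto hm) hm r).add const
  rw [zero_add] at main
  refine main.congr fun N => ?_
  rw [← add_div, ← Finset.sum_add_distrib]
  congr 1
  refine Finset.sum_congr rfl fun i _ => ?_
  rw [sub_add_cancel, hv, show (i + 1) * m + r = i * m + r + m by ring]

theorem theorem1 (a : ℕ → ℕ+) (x : ℝ) (hx : HasCFValue (fun i => a (i + 1)) x)
    (hnormal : CFNormal x) (k m : ℕ) (hk : 1 ≤ k) (hm : 2 ≤ m) :
    (∃ y : ℝ, HasCFValue (fun i => a (i * m + k)) y ∧ y ∈ Ico (0 : ℝ) 1 ∧ ¬ CFNormal y) ∧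
    Tendsto
      (fun n : ℕ =>
        ({i : ℕ | 1 ≤ i ∧ i ≤ n ∧ a ((i - 1) * m + k) = 1 ∧ a (i * m + k) = 1}.ncard : ℝ) / n)
      atTop (𝓝 (gaussMeasure.real (cfCylinder [1] ∩ gaussMap^[m] ⁻¹' cfCylinder [1]))) ∧
    gaussMeasure.real (cfCylinder [1, 1]) <
      gaussMeasure.real (cfCylinder [1] ∩ gaussMap^[m] ⁻¹' cfCylinder [1]) ∧
    gaussMeasure.real (cfCylinder [1, 1]) = Real.log (10 / 9) / Real.log 2 := by
  have hlt := measureReal_cfCylinder_one_one_lt hm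
  -- The digit of `x` at zero-based position `i` is `a (i + 1)`, whence the offset `k - 1`.
  have freq := tendsto_frequency_ones_progression hx hnormal (one_le_two.trans hm) (k - 1)
  have hk' : ∀ i, i * m + (k - 1) + 1 = i * m + k := fun i => by omega
  simp only [hk'] at freq
  refine ⟨?_, ?_, hlt, gaussMeasure_real_cfCylinder_one_one⟩
  · obtain ⟨y, hy⟩ := exists_hasCFValue fun i => a (i * m + k)
    refine ⟨y, hy, Ioo_subset_Ico_self hy.mem_Ioo, fun hyn => hlt.ne ?_⟩
    -- Were `y` CF-normal, the frequency of `[1, 1]` would converge to two different limits.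
    refine tendsto_nhds_unique (hyn.tendsto_average (s := [1, 1]) (by simp)) (freq.congr fun N => ?_)
    congr 1
    refine Finset.sum_congr rfl fun n _ => ite_one_zero_congr ?_
    rw [hy.iterate_mem_cfCylinder_iff]
    refine ⟨?_, fun h => ⟨h 0 (by simp), h 1 (by simp)⟩⟩
    rintro ⟨h0, h1⟩ i hi
    have : i < 2 := hi
    interval_cases i
    · exact h0
    · exact h1
  · refine freq.congr fun n => ?_
    congr 1
    rw [Finset.sum_boole, ← ncard_coe_finset, ← ncard_image_of_injective _ (add_left_injective 1)]
    congr 2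
    ext i
    simp only [Finset.coe_filter, Finset.mem_range, mem_image, mem_ofPred_eq]
    constructor
    · rintro ⟨j, ⟨hj, h0, h1⟩, rfl⟩
      exact ⟨by omega, by omega, h0, h1⟩
    · rintro ⟨h1, hn, h2, h3⟩
      refine ⟨i - 1, ⟨by omega, h2, ?_⟩, by omega⟩
      rwa [Nat.sub_add_cancel h1]
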